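/- Let $P\subset\mathbf R^3$ be a convex polyhedron (a bounded set that lies in no plane and is an intersection of finitely many closed half-spaces), with sets $\mathcal V,\mathcal F$ of vertices and faces, of sizes $V,F$, and with $E$ edges, and suppose that no plane containing a face of $P$ passes through the origin. Let $\mathcal I\subset\mathcal V\times\mathcal F$ be the set of pairs $(v,f)$ such that $v$ lies on $f$, and let $\Pi=(\mathcal V,\mathcal F,\mathcal I)$. A realization of $\Pi$ assigns to each $v\in\mathcal V$ a point of $\mathbf R^3$ and to each $f\in\mathcal F$ a plane in $\mathbf R^3$, such that the point of $v$ lies on the plane of $f$ whenever $(v,f)\in\mathcal I$; the set of realizations carries its natural topology, as a subspace of the product of copies of $\mathbf R^3$ and of the space of planes. $P$ itself gives a realization, also denoted $P$. Two realizations are congruent if a composition of rotations and translations takes one to the other. A measurement for $P$ is a smooth real-valued function defined on an open neighbourhood of $P$ in the space of realizations that is invariant under rotations and translations. A realization $Q$ none of whose planes passes through the origin is described by the vector in $\mathbf R^{3V+3F}$ consisting of the coordinates $(x_i,y_i,z_i)$ of its points and of the coefficients $(a_j,b_j,c_j)$ of the equations $a_jx+b_jy+c_jz=1$ of its planes. Smoothness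 of a function of realizations means that in these coordinates (after a translation, if needed) it extends locally to a smooth function on an open subset of $\mathbf R^{3V+3F}$. Let $\phi\colon\mathbf R^{3V+3F}\to\mathbf R^{\mathcal I}$ have the components $\phi_{i,j}=a_jx_i+b_jy_i+c_jz_i-1$, for $(v_i,f_j)\in\mathcal I$. **Theorem.** Let $S$ be a finite set of measurements for $P$. Extend each $m\in S$ in any way to a smooth function on a neighbourhood of $P$ in $\mathbf R^{3V+3F}$, let $\psi$ be the $\mathbf R^{|S|}$-valued function with these extensions as components, and let $D\phi(P)$, $D\psi(P)$ be the Jacobian matrices at $P$. Then the matrix $$D(\phi,\psi)(P)=\begin{pmatrix}D\phi(P)\\ D\psi(P)\end{pmatrix}$$ has rank at most $3E$. If its rank is exactly $3E$, then every realization $Q$ of $\Pi$ sufficiently close to $P$ such that $m(Q)=m(P)$ for all $m\in S$ is congruent to $P$. -/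

import Mathlib

open Topology
open scoped ContDiff InnerProductSpace

noncomputable section

/-- Euclidean three-space. -/
abbrev E3 : Type := EuclideanSpace ℝ (Fin 3)

/-! ### Half-spaces and planes -/

/-- A closed half-space `{p | a x + b y + c z + d ≥ 0}` with `(a, b, c) ≠ 0`. -/
def IsClosedHalfSpace (H : Set E3) : Prop :=
  ∃ (n : E3) (d : ℝ), n ≠ 0 ∧ H = {p | 0 ≤ ⟪n, p⟫_ℝ + d}

/-- The set of solutions of `⟪n, p⟫ = d`. -/
def planeSet (n : E3) (d : ℝ) : Set E3 := {p | ⟪n, p⟫_ℝ = d}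

/-- A plane of three-space, as a set of points. -/
def Plane : Type := {K : Set E3 // ∃ (n : E3) (d : ℝ), n ≠ 0 ∧ K = planeSet n d}

namespace Plane

/-- The plane with equation `⟪n, p⟫ = d`, where `n ≠ 0`. -/
def mk (q : {q : E3 × ℝ // q.1 ≠ 0}) : Plane :=
  ⟨planeSet q.1.1 q.1.2, q.1.1, q.1.2, q.2, rfl⟩

/-- The natural topology on the set of planes: the quotient topology coming from the
coefficients `(n, d)`, `n ≠ 0`, of an equation of the plane. -/
instance : TopologicalSpace Plane := TopologicalSpace.coinduced Plane.mk inferInstance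

/-- The image of a plane under an isometry of space. -/
def move (g : E3 ≃ᵃⁱ[ℝ] E3) (K : Plane) : Plane :=
  ⟨g '' K.1, by
    obtain ⟨K, n, d, hn, rfl⟩ := K
    refine ⟨g.linearIsometryEquiv n, d + ⟪g.linearIsometryEquiv n, g 0⟫_ℝ, ?_, ?_⟩
    · simpa using hn
    · have key : ∀ p : E3, ⟪g.linearIsometryEquiv n, g p⟫_ℝ
          = ⟪n, p⟫_ℝ + ⟪g.linearIsometryEquiv n, g 0⟫_ℝ := by
        intro p
        have h : g p = g.linearIsometryEquiv p + g 0 := by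
          have := g.map_vadd (0 : E3) p
          simpa using this
        rw [h, inner_add_right, LinearIsometryEquiv.inner_map_map]
      ext y
      constructor
      · rintro ⟨p, hp, rfl⟩
        have hp' : ⟪n, p⟫_ℝ = d := hp
        change _ = _
        rw [key, hp']
      · intro hy
        have hy' : ⟪g.linearIsometryEquiv n, y⟫_ℝ
            = d + ⟪g.linearIsometryEquiv n, g 0⟫_ℝ := hy
        refine ⟨g.symm y, ?_, by simp⟩
        have := key (g.symm y)
        rw [AffineIsometryEquiv.apply_symm_apply, hy'] at this
        change _ = _
        linarith⟩

open Classical in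
/-- For a plane that misses the origin, the unique vector `(a, b, c)` such that
`a x + b y + c z = 1` is an equation of the plane (and `0` for the other planes). -/
def coeff (K : Plane) : E3 :=
  if h : ∃ a : E3, K.1 = planeSet a 1 then h.choose else 0

/-- `coeff` gives an equation of every plane that misses the origin. -/
theorem eq_planeSet_coeff (K : Plane) (hK : (0 : E3) ∉ K.1) : K.1 = planeSet K.coeff 1 := by
  have h : ∃ a : E3, K.1 = planeSet a 1 := by
    obtain ⟨K, n, d, hn, rfl⟩ := K
    have hd : d ≠ 0 := fun h => hK (by simp [planeSet, h])
    refine ⟨d⁻¹ • n, ?_⟩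
    ext p
    simp only [planeSet, Set.mem_ofPred_eq, real_inner_smul_left]
    constructor
    · intro h; rw [h, inv_mul_cancel₀ hd]
    · intro h; field_simp at h; exact h
  unfold coeff
  rw [dif_pos h]
  exact h.choose_spec

end Plane

/-! ### Convex polyhedra -/

/-- A convex polyhedron: a bounded subset of three-space which does not lie in any plane and
is an intersection of finitely many closed half-spaces. -/
structure ConvexPolyhedron where
  carrier : Set E3
  isBounded : Bornology.IsBounded carrier
  not_subset_plane : ∀ K : Plane, ¬ carrier ⊆ K.1
  exists_halfSpaces : ∃ s : Set (Set E3), s.Finite ∧ (∀ H ∈ s, IsClosedHalfSpace H) ∧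
    carrier = ⋂₀ s

namespace ConvexPolyhedron

/-- The vertices: points `v` such that `P ∩ H = {v}` for some closed half-space `H`. -/
def vertices (P : ConvexPolyhedron) : Set E3 :=
  {v | ∃ H, IsClosedHalfSpace H ∧ P.carrier ∩ H = {v}}

/-- The edges: the sets `P ∩ H`, with `H` a closed half-space, that lie in a line and have
more than one point. -/
def edges (P : ConvexPolyhedron) : Set (Set E3) :=
  {e | (∃ H, IsClosedHalfSpace H ∧ e = P.carrier ∩ H) ∧ Collinear ℝ e ∧ e.Nontrivial}

/-- The faces: the sets `P ∩ H`, with `H` a closed half-space, that lie in a plane but not in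
a line. -/
def faces (P : ConvexPolyhedron) : Set (Set E3) :=
  {f | (∃ H, IsClosedHalfSpace H ∧ f = P.carrier ∩ H) ∧ (∃ K : Plane, f ⊆ K.1) ∧
    ¬ Collinear ℝ f}

theorem finite_planar_sections (P : ConvexPolyhedron) :
    {G : Set E3 | (∃ H, IsClosedHalfSpace H ∧ G = P.carrier ∩ H) ∧ (∃ K : Plane, G ⊆ K.1) ∧
      G.Nonempty}.Finite := by
  classical
  obtain ⟨s, hs, hH, hP⟩ := P.exists_halfSpaces
  choose! N D hN hND using hH
  have hmem : ∀ p, p ∈ P.carrier ↔ ∀ H ∈ s, 0 ≤ ⟪N H, p⟫_ℝ + D H := by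
    intro p
    rw [hP, Set.mem_sInter]
    refine forall₂_congr fun H hHs => ?_
    conv_lhs => rw [hND H hHs]
    rfl
  have lin : ∀ (n : E3) (d : ℝ) (y p : E3) (t : ℝ),
      ⟪n, y + t • (p - y)⟫_ℝ + d = (1 - t) * (⟪n, y⟫_ℝ + d) + t * (⟪n, p⟫_ℝ + d) := by
    intro n d y p t
    rw [inner_add_right, real_inner_smul_right, inner_sub_right]
    ring
  -- the half-space defining a planar section supports the polyhedron
  have supp : ∀ (n : E3) (d : ℝ) (K : Plane), P.carrier ∩ {p | 0 ≤ ⟪n, p⟫_ℝ + d} ⊆ K.1 →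
      ∀ y ∈ P.carrier, ⟪n, y⟫_ℝ + d ≤ 0 := by
    intro n d K hK y hy
    by_contra! hpos
    refine P.not_subset_plane K fun p hp => ?_
    obtain ⟨t, ht0, ht1, ht⟩ : ∃ t : ℝ, 0 < t ∧ t ≤ 1 ∧
        0 ≤ (1 - t) * (⟪n, y⟫_ℝ + d) + t * (⟪n, p⟫_ℝ + d) := by
      set a := ⟪n, y⟫_ℝ + d
      set b := ⟪n, p⟫_ℝ + d
      refine ⟨a / (a + |b|), by positivity, ?_, ?_⟩
      · rw [div_le_one (by positivity)]; linarith [abs_nonneg b]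
      · have h1 : 0 < a + |b| := by positivity
        have h2 : (1 - a / (a + |b|)) * a + a / (a + |b|) * b = a * (|b| + b) / (a + |b|) := by
          field_simp
          ring
        rw [h2]
        have : 0 ≤ |b| + b := by linarith [neg_abs_le b]
        positivity
    have hyK : y ∈ K.1 := hK ⟨hy, le_of_lt hpos⟩
    have hqK : y + t • (p - y) ∈ K.1 := by
      refine hK ⟨?_, ?_⟩
      · rw [hmem] at hy hp ⊢
        intro H hHs
        rw [lin]
        have := hy H hHs
        have := hp H hHs
        have : 0 ≤ 1 - t := by linarith
        positivity
      · rw [Set.mem_ofPred_eq, lin]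
        exact ht
    obtain ⟨K, n', d', hn', rfl⟩ := K
    have h1 : ⟪n', y⟫_ℝ = d' := hyK
    have h2 : ⟪n', y + t • (p - y)⟫_ℝ = d' := hqK
    have h3 := lin n' (-d') y p t
    rw [h1, h2] at h3
    have h4 : t * (⟪n', p⟫_ℝ + -d') = 0 := by linarith
    rcases mul_eq_zero.1 h4 with h | h
    · exact absurd h ht0.ne'
    · change _ = _
      linarith
  -- a planar section is determined by the half-spaces whose boundary planes contain it
  refine Set.Finite.of_finite_image
    (f := fun G => {H | H ∈ s ∧ ∀ p ∈ G, ⟪N H, p⟫_ℝ + D H = 0})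
    (hs.finite_subsets.subset ?_) ?_
  · rintro _ ⟨G, -, rfl⟩
    exact fun H h => h.1
  have main : ∀ G G' : Set E3,
      ((∃ H, IsClosedHalfSpace H ∧ G = P.carrier ∩ H) ∧ (∃ K : Plane, G ⊆ K.1) ∧ G.Nonempty) →
      G' ⊆ P.carrier →
      (∀ H ∈ s, (∀ p ∈ G, ⟪N H, p⟫_ℝ + D H = 0) → (∀ p ∈ G', ⟪N H, p⟫_ℝ + D H = 0)) →
      G' ⊆ G := by
    rintro G G' ⟨⟨H₀, ⟨n, d, -, rfl⟩, rfl⟩, ⟨K, hK⟩, hne⟩ hG' hact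
    have hsup := supp n d K hK
    have hGmem : ∀ p, p ∈ P.carrier ∩ {p | 0 ≤ ⟪n, p⟫_ℝ + d} ↔
        p ∈ P.carrier ∧ 0 ≤ ⟪n, p⟫_ℝ + d := fun p => Iff.rfl
    generalize hG : P.carrier ∩ {p | 0 ≤ ⟪n, p⟫_ℝ + d} = G at *
    -- a point of the section that is as generic as possible
    have gen : ∀ u : Finset (Set E3), (↑u ⊆ s) → ∃ z ∈ G, ∀ H ∈ u,
        (∃ p ∈ G, ⟪N H, p⟫_ℝ + D H ≠ 0) → 0 < ⟪N H, z⟫_ℝ + D H := by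
      intro u
      induction u using Finset.induction_on with
      | empty => intro _; obtain ⟨z, hz⟩ := hne; exact ⟨z, hz, by simp⟩
      | insert H u hHu ih =>
        intro hus
        obtain ⟨z, hz, hzu⟩ := ih fun x hx => hus (by simp [Finset.mem_coe.1 hx])
        have hHs : H ∈ s := hus (by simp)
        have conv : ∀ p ∈ G, z + (1 / 2 : ℝ) • (p - z) ∈ G := by
          intro p hp
          rw [hGmem] at hz hp ⊢
          refine ⟨?_, ?_⟩
          · rw [hmem]
            intro H' hH'
            rw [lin]
            linarith [(hmem z).1 hz.1 H' hH', (hmem p).1 hp.1 H' hH']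
          · rw [lin]
            linarith [hz.2, hp.2]
        by_cases hex : ∃ p ∈ G, ⟪N H, p⟫_ℝ + D H ≠ 0
        · obtain ⟨p, hp, hpH⟩ := hex
          have hzP := (hmem z).1 ((hGmem z).1 hz).1
          have hpP := (hmem p).1 ((hGmem p).1 hp).1
          refine ⟨z + (1 / 2 : ℝ) • (p - z), conv p hp, ?_⟩
          intro H' hH' hex'
          rw [lin]
          rcases Finset.mem_insert.1 hH' with rfl | hH'
          · have := lt_of_le_of_ne (hpP H' hHs) (Ne.symm hpH)
            linarith [hzP H' hHs]
          · have := hzu H' hH' hex'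
            linarith [hpP H' (hus (by simp [hH']))]
        · refine ⟨z, hz, ?_⟩
          intro H' hH' hex'
          rcases Finset.mem_insert.1 hH' with rfl | hH'
          · exact absurd hex' hex
          · exact hzu H' hH' hex'
    obtain ⟨z, hz, hzs⟩ := gen hs.toFinset (by simp)
    intro y hy
    have hyP := hG' hy
    have hzP := ((hGmem z).1 hz).1
    -- the segment from `y` to `z` can be prolonged beyond `z`
    have ext : ∃ t : ℝ, 0 < t ∧ z + (-t) • (y - z) ∈ P.carrier := by
      have : ∀ u : Finset (Set E3), (↑u ⊆ s) → ∃ t : ℝ, 0 < t ∧ ∀ H ∈ u, ∀ t' : ℝ, 0 < t' → t' ≤ t →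
          0 ≤ ⟪N H, z + (-t') • (y - z)⟫_ℝ + D H := by
        intro u
        induction u using Finset.induction_on with
        | empty => intro _; exact ⟨1, one_pos, by simp⟩
        | insert H u hHu ih =>
          intro hus
          obtain ⟨t, ht, htu⟩ := ih fun x hx => hus (by simp [Finset.mem_coe.1 hx])
          have hHs : H ∈ s := hus (by simp)
          have hyH := (hmem y).1 hyP H hHs
          obtain ⟨t₁, ht₁, hH₁⟩ : ∃ t₁ : ℝ, 0 < t₁ ∧ ∀ t' : ℝ, 0 < t' → t' ≤ t₁ →
              0 ≤ ⟪N H, z + (-t') • (y - z)⟫_ℝ + D H := by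
            by_cases hex : ∃ p ∈ G, ⟪N H, p⟫_ℝ + D H ≠ 0
            · have hzH := hzs H (by simpa using hHs) hex
              refine ⟨(⟪N H, z⟫_ℝ + D H) / (1 + (⟪N H, y⟫_ℝ + D H)), by positivity, ?_⟩
              intro t' ht' hle
              rw [lin]
              rw [le_div_iff₀ (by positivity)] at hle
              nlinarith [mul_pos ht' hzH]
            · push Not at hex
              have h1 := hex z hz
              have h2 := hact H hHs hex y hy
              refine ⟨1, one_pos, fun t' _ _ => ?_⟩
              rw [lin, h1, h2]
              simp
          refine ⟨min t t₁, lt_min ht ht₁, ?_⟩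
          intro H' hH' t' ht' hle
          rcases Finset.mem_insert.1 hH' with rfl | hH'
          · exact hH₁ t' ht' (hle.trans (min_le_right _ _))
          · exact htu H' hH' t' ht' (hle.trans (min_le_left _ _))
      obtain ⟨t, ht, htu⟩ := this hs.toFinset (by simp)
      exact ⟨t, ht, (hmem _).2 fun H hHs => htu H (by simpa using hHs) t ht le_rfl⟩
    obtain ⟨t, ht, hq⟩ := ext
    have h1 := hsup _ hq
    rw [lin] at h1
    have h2 := ((hGmem z).1 hz).2
    refine (hGmem y).2 ⟨hyP, ?_⟩
    by_contra! hneg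
    nlinarith [mul_pos ht (neg_pos.2 hneg), mul_nonneg ht.le h2]
  intro G hG G' hG' heq
  have hiff : ∀ H ∈ s, (∀ p ∈ G, ⟪N H, p⟫_ℝ + D H = 0) ↔ (∀ p ∈ G', ⟪N H, p⟫_ℝ + D H = 0) := by
    intro H hHs
    have := Set.ext_iff.1 heq H
    simpa [hHs] using this
  refine Set.Subset.antisymm ?_ ?_
  · refine main G' G hG' ?_ fun H hHs => (hiff H hHs).2
    obtain ⟨⟨H, -, h⟩, -⟩ := hG
    rw [h]; exact Set.inter_subset_left
  · refine main G G' hG ?_ fun H hHs => (hiff H hHs).1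
    obtain ⟨⟨H, -, h⟩, -⟩ := hG'
    rw [h]; exact Set.inter_subset_left

theorem exists_plane_of_collinear {e : Set E3} (he : Collinear ℝ e) :
    ∃ K : Plane, e ⊆ K.1 := by
  obtain ⟨p₀, v, hv⟩ := (collinear_iff_exists_forall_eq_smul_vadd (k := ℝ) e).1 he
  obtain ⟨n, hn, hnv⟩ : ∃ n : E3, n ≠ 0 ∧ ⟪n, v⟫_ℝ = 0 := by
    have hlt : Module.finrank ℝ (ℝ ∙ v) < Module.finrank ℝ E3 := by
      have := finrank_span_le_card (R := ℝ) ({v} : Set E3)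
      simp only [Set.toFinset_singleton, Finset.card_singleton] at this
      have h3 : Module.finrank ℝ E3 = 3 := by simp
      omega
    have hne : (ℝ ∙ v)ᗮ ≠ ⊥ := by
      intro h
      rw [Submodule.orthogonal_eq_bot_iff] at h
      rw [h, finrank_top] at hlt
      exact lt_irrefl _ hlt
    obtain ⟨n, hn, hn0⟩ := Submodule.exists_mem_ne_zero_of_ne_bot hne
    refine ⟨n, hn0, ?_⟩
    rw [real_inner_comm]
    exact (Submodule.mem_orthogonal_singleton_iff_inner_right).1 hn
  refine ⟨Plane.mk ⟨(n, ⟪n, p₀⟫_ℝ), hn⟩, fun p hp => ?_⟩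
  obtain ⟨r, rfl⟩ := hv p hp
  change ⟪n, r • v +ᵥ p₀⟫_ℝ = ⟪n, p₀⟫_ℝ
  rw [vadd_eq_add, inner_add_right, real_inner_smul_right, hnv]
  simp

theorem finite_vertices (P : ConvexPolyhedron) : P.vertices.Finite := by
  refine Set.Finite.of_finite_image (f := fun v => ({v} : Set E3))
    (P.finite_planar_sections.subset ?_) Set.singleton_injective.injOn
  rintro _ ⟨v, ⟨H, hH, h⟩, rfl⟩
  exact ⟨⟨H, hH, h.symm⟩, exists_plane_of_collinear (collinear_singleton ℝ v),
    Set.singleton_nonempty v⟩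

theorem finite_edges (P : ConvexPolyhedron) : P.edges.Finite := by
  refine P.finite_planar_sections.subset ?_
  rintro e ⟨hH, hc, hn⟩
  exact ⟨hH, exists_plane_of_collinear hc, hn.nonempty⟩

theorem finite_faces (P : ConvexPolyhedron) : P.faces.Finite := by
  refine P.finite_planar_sections.subset ?_
  rintro e ⟨hH, hK, hn⟩
  refine ⟨hH, hK, ?_⟩
  rw [Set.nonempty_iff_ne_empty]
  rintro rfl
  exact hn (collinear_empty ℝ E3)

/-- The type of vertices of the underlying abstract polyhedron. -/
abbrev Vertex (P : ConvexPolyhedron) : Type := P.vertices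

/-- The type of faces of the underlying abstract polyhedron. -/
abbrev Face (P : ConvexPolyhedron) : Type := P.faces

/-- The incidence relation of the underlying abstract polyhedron, as the type of incident
(vertex, face) pairs. -/
abbrev Incidence (P : ConvexPolyhedron) : Type := {q : P.Vertex × P.Face // q.1.1 ∈ q.2.1}

/-- The number of edges. -/
def numEdges (P : ConvexPolyhedron) : ℕ := P.edges.ncard

instance (P : ConvexPolyhedron) : Fintype P.Vertex := P.finite_vertices.fintype

instance (P : ConvexPolyhedron) : Fintype P.Face := P.finite_faces.fintype

end ConvexPolyhedron

/-! ### Realizations -/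

/-- A realization of the underlying abstract polyhedron of `P`: a point for every vertex and a
plane for every face, such that the point lies on the plane whenever the vertex lies on the
face. -/
structure Realization (P : ConvexPolyhedron) where
  vertex : P.Vertex → E3
  face : P.Face → Plane
  incident : ∀ (v : P.Vertex) (f : P.Face), v.1 ∈ f.1 → vertex v ∈ (face f).1

namespace Realization

variable {P : ConvexPolyhedron}

/-- The natural topology on the space of realizations, as a subspace of the product of copies
of three-space and copies of the space of planes. -/
instance : TopologicalSpace (Realization P) :=
  TopologicalSpace.induced (fun Q => (Q.vertex, Q.face)) inferInstance

/-- The image of a realization under an isometry of space. -/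
def move (g : E3 ≃ᵃⁱ[ℝ] E3) (Q : Realization P) : Realization P where
  vertex v := g (Q.vertex v)
  face f := (Q.face f).move g
  incident v f h := ⟨Q.vertex v, Q.incident v f h, rfl⟩

/-- The translate of a realization by a vector. -/
def translate (t : E3) (Q : Realization P) : Realization P :=
  Q.move (AffineIsometryEquiv.constVAdd ℝ E3 t)

/-- No plane of the realization passes through the origin. -/
def AvoidsOrigin (Q : Realization P) : Prop := ∀ f, (0 : E3) ∉ (Q.face f).1

end Realization

/-- A rigid motion (composition of rotations and translations): an isometry whose linear part
has determinant one. -/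
def IsRigidMotion (g : E3 ≃ᵃⁱ[ℝ] E3) : Prop :=
  LinearMap.det (g.linearIsometryEquiv.toLinearEquiv : E3 →ₗ[ℝ] E3) = 1

/-- Two realizations are congruent if a rigid motion takes the one to the other. -/
def Realization.Congruent {P : ConvexPolyhedron} (Q R : Realization P) : Prop :=
  ∃ g, IsRigidMotion g ∧ Q.move g = R

/-- The realization given by `P` itself: every vertex is placed where it is, and every face is
sent to the plane that contains it (there is only one, as a face does not lie in a line). -/
def ConvexPolyhedron.toRealization (P : ConvexPolyhedron) : Realization P where
  vertex v := v.1
  face f := f.2.2.1.choose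
  incident _ f h := f.2.2.1.choose_spec h

/-! ### Coordinates -/

/-- The index set of the `3V + 3F` coordinates. -/
abbrev CoordIndex (P : ConvexPolyhedron) : Type := (P.Vertex ⊕ P.Face) × Fin 3

/-- The coordinate space `ℝ^(3V+3F)`. -/
abbrev CoordSpace (P : ConvexPolyhedron) : Type := CoordIndex P → ℝ

/-- The coordinates of a realization none of whose planes passes through the origin: the
coordinates `(x_i, y_i, z_i)` of the vertices, and the coefficients `(a_j, b_j, c_j)` of the
equations `a_j x + b_j y + c_j z = 1` of the planes. -/
def Realization.coords {P : ConvexPolyhedron} (Q : Realization P) : CoordSpace P :=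
  fun k => (Sum.elim Q.vertex (fun f => (Q.face f).coeff) k.1 : E3) k.2

/-- The vertex-on-face functions `φ_{i,j} = a_j x_i + b_j y_i + c_j z_i - 1`. -/
def phi (P : ConvexPolyhedron) (q : P.Incidence) (x : CoordSpace P) : ℝ :=
  (∑ i : Fin 3, x (Sum.inr q.1.2, i) * x (Sum.inl q.1.1, i)) - 1

open Classical in
/-- The Jacobian matrix at `x` of the vector-valued function with components `Φ r`. -/
def jacobian {P : ConvexPolyhedron} {ρ : Type*} (Φ : ρ → CoordSpace P → ℝ) (x : CoordSpace P) :
    Matrix ρ (CoordIndex P) ℝ :=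
  Matrix.of fun r k => fderiv ℝ (Φ r) x (Pi.single k 1)

/-! ### Measurements -/

/-- Smoothness of a function `m` on an open set `U` of realizations. Each realization has a
translate none of whose planes passes through the origin, and the coordinates of that translate
identify a neighbourhood of the realization with a subset of `ℝ^(3V+3F)`; a function on such a
subset is smooth if it extends, locally at each point, to a smooth function on an open subset of
`ℝ^(3V+3F)`. -/
def IsSmoothOn {P : ConvexPolyhedron} (U : Set (Realization P)) (m : Realization P → ℝ) : Prop :=
  ∀ Q ∈ U, ∀ t : E3, (Q.translate t).AvoidsOrigin →
    ∃ (W : Set (CoordSpace P)) (M : CoordSpace P → ℝ),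
      IsOpen W ∧ (Q.translate t).coords ∈ W ∧ ContDiffOn ℝ ∞ M W ∧
      ∀ R ∈ U, (R.translate t).AvoidsOrigin → (R.translate t).coords ∈ W →
        M (R.translate t).coords = m R

/-- A measurement for `P`: a smooth function on an open neighbourhood `domain` of `P` in the
space of realizations, invariant under rotations and translations. The values of `toFun` outside
`domain` are irrelevant. -/
structure Measurement (P : ConvexPolyhedron) where
  domain : Set (Realization P)
  isOpen_domain : IsOpen domain
  mem_domain : P.toRealization ∈ domain
  toFun : Realization P → ℝ
  smooth : IsSmoothOn domain toFun
  invariant : ∀ g, IsRigidMotion g → ∀ Q ∈ domain, Q.move g ∈ domain →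
    toFun (Q.move g) = toFun Q

/-- `M` is smooth on a neighbourhood of `P` in the coordinate space `ℝ^(3V+3F)`, and extends
there the measurement `m`. -/
def Measurement.IsExtension {P : ConvexPolyhedron} (m : Measurement P)
    (M : CoordSpace P → ℝ) : Prop :=
  ∃ W : Set (CoordSpace P), IsOpen W ∧ P.toRealization.coords ∈ W ∧ ContDiffOn ℝ ∞ M W ∧
    ∀ Q ∈ m.domain, Q.AvoidsOrigin → Q.coords ∈ W → M Q.coords = m.toFun Q

end

noncomputable section

/-! Rigid motions preserve the incidence equations and the measurements, so the infinitesimal rigid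
motions, written in coordinates as `rigidVelocity`, lie in the kernel of the Jacobian
(`Realization.fderiv_velocity_eq_zero`). They form a space of dimension six, because P has four
vertices in general position. Hence the rank is at most 3V + 3F - 6, and V + F ≤ E + 2 bounds this
by 3E.

That half of Euler's formula (`card_vertex_add_card_face_le`) is homological. Over ℤ/2 the
edge-vertex and edge-face incidence matrices have ranks at least V - 1 and F - 1, because the edge
graph and the adjacency graph of the faces are connected. The two matrices are orthogonal, because a
face has exactly two edges at each of its vertices; so the ranks add up to at most E. The
combinatorics is read off from a presentation of P by finitely many inequalities: vertices, edges
and faces are the cells cut out by sets of active inequalities. The cone lemma `exists_two_facets`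
gives the two faces at an edge and the two edges of a flag, and connectedness follows by improving a
functional along edges (`exists_edge_improving`) or across them (`exists_face_improving`).

If the rank is 3E, the same count shows that the kernel consists of the infinitesimal rigid motions
only. Adjoin six linear coordinates transverse to these motions (`sliceMap`). The enlarged map has
injective derivative at P, so near P it takes the value it has at P nowhere else. A realization Q
near P is carried into the slice through P by a small rigid motion comparing Gram–Schmidt frames
(`exists_move_mem_slice`). If Q has the measurements of P, then the moved Q and P have the same
image under the enlarged map, so they coincide. No manifold structure on the space of realizations
is needed. -/

/-- The first time at which one of finitely many affine functions, nonnegative at time `0` and not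
all nondecreasing, vanishes while decreasing. -/
theorem exists_exit_time {ι : Type*} [Finite ι] {a b : ι → ℝ} (ha : ∀ i, 0 ≤ a i)
    (hb : ∃ i, b i < 0) :
    ∃ t : ℝ, 0 ≤ t ∧ (∀ i, 0 ≤ a i + t * b i) ∧ ∃ i, b i < 0 ∧ a i + t * b i = 0 := by
  obtain ⟨i, hi, hmin⟩ := Set.exists_min_image {i | b i < 0} (fun i => a i / -b i)
    (Set.toFinite _) hb
  have hi' : b i < 0 := hi
  have ht : 0 ≤ a i / -b i := div_nonneg (ha i) (by linarith)
  refine ⟨a i / -b i, ht, fun j => ?_, i, hi', ?_⟩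
  · rcases lt_or_ge (b j) 0 with hj | hj
    · have h1 := hmin j hj
      rw [le_div_iff₀ (by linarith)] at h1
      linarith
    · have := ha j
      positivity
  · rw [div_neg, neg_mul, div_mul_cancel₀ _ hi'.ne, add_neg_cancel]

/-! ### Faces of all dimensions as cells of active inequalities -/

/-- A presentation of a convex polyhedron by finitely many linear inequalities. -/
structure HalfSpaceRep (P : ConvexPolyhedron) where
  ι : Type
  finite : Finite ι
  normal : ι → E3
  offset : ι → ℝ
  normal_ne : ∀ i, normal i ≠ 0
  mem_iff : ∀ p, p ∈ P.carrier ↔ ∀ i, 0 ≤ ⟪normal i, p⟫_ℝ + offset i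

theorem ConvexPolyhedron.exists_halfSpaceRep (P : ConvexPolyhedron) :
    Nonempty (HalfSpaceRep P) := by
  obtain ⟨s, hs, hH, hP⟩ := P.exists_halfSpaces
  obtain ⟨k, ⟨e⟩⟩ := hs.exists_equiv_fin
  choose N D hN hND using fun i : Fin k => hH _ (e.symm i).2
  refine ⟨⟨Fin k, inferInstance, N, D, hN, fun p => ?_⟩⟩
  rw [hP, Set.mem_sInter]
  constructor
  · intro h i
    have := h _ (e.symm i).2
    rw [hND i] at this
    exact this
  · intro h H hHs
    have h1 := hND (e ⟨H, hHs⟩)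
    have h2 := h (e ⟨H, hHs⟩)
    simp only [Equiv.symm_apply_apply] at h1
    rw [h1]
    exact h2

namespace HalfSpaceRep

variable {P : ConvexPolyhedron} (h : HalfSpaceRep P)

/-- The value at a point of the affine function defining one of the half-spaces. -/
def val (i : h.ι) (p : E3) : ℝ := ⟪h.normal i, p⟫_ℝ + h.offset i

/-- The inequalities that are equalities at a point. -/
def active (z : E3) : Set h.ι := {i | h.val i z = 0}

/-- The directions in which all active inequalities remain equalities. -/
def dirs (z : E3) : Submodule ℝ E3 where
  carrier := {u | ∀ i ∈ h.active z, ⟪h.normal i, u⟫_ℝ = 0}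
  add_mem' := by
    intro a b ha hb i hi
    rw [inner_add_right, ha i hi, hb i hi, add_zero]
  zero_mem' := by intro i _; simp
  smul_mem' := by
    intro c a ha i hi
    rw [real_inner_smul_right, ha i hi, mul_zero]

/-- The smallest face (of any dimension) containing a point. -/
def cell (z : E3) : Set E3 := {x | x ∈ P.carrier ∧ h.active z ⊆ h.active x}

variable {h}

theorem mem_dirs {z u : E3} : u ∈ h.dirs z ↔ ∀ i ∈ h.active z, ⟪h.normal i, u⟫_ℝ = 0 := Iff.rfl

theorem mem_active {z : E3} {i : h.ι} : i ∈ h.active z ↔ h.val i z = 0 := Iff.rfl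

theorem mem_carrier {p : E3} : p ∈ P.carrier ↔ ∀ i, 0 ≤ h.val i p := h.mem_iff p

theorem val_add_smul (i : h.ι) (z w : E3) (t : ℝ) :
    h.val i (z + t • w) = h.val i z + t * ⟪h.normal i, w⟫_ℝ := by
  simp only [val, inner_add_right, real_inner_smul_right]; ring

theorem inner_sub_eq (i : h.ι) (x z : E3) :
    ⟪h.normal i, x - z⟫_ℝ = h.val i x - h.val i z := by
  simp only [val, inner_sub_right]; ring

theorem val_pos {z : E3} (hz : z ∈ P.carrier) {i : h.ι} (hi : i ∉ h.active z) :
    0 < h.val i z := lt_of_le_of_ne (h.mem_carrier.1 hz i) (Ne.symm hi)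

theorem mem_cell_self {z : E3} (hz : z ∈ P.carrier) : z ∈ h.cell z := ⟨hz, subset_rfl⟩

/-- Since z lies in its own cell, it suffices to test the inclusion at z. Inclusions between faces
thus become reversed inclusions between finite sets of indices. -/
theorem cell_subset_iff {z y : E3} (hz : z ∈ P.carrier) :
    h.cell z ⊆ h.cell y ↔ h.active y ⊆ h.active z :=
  ⟨fun H => (H (mem_cell_self hz)).2, fun H _ hx => ⟨hx.1, H.trans hx.2⟩⟩

theorem cell_eq_of_active_eq {z y : E3} (H : h.active z = h.active y) : h.cell z = h.cell y := by
  simp only [cell, H]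

theorem active_eq_of_cell_eq {z y : E3} (hz : z ∈ P.carrier) (hy : y ∈ P.carrier)
    (H : h.cell z = h.cell y) : h.active z = h.active y :=
  ((cell_subset_iff hy).1 H.ge).antisymm ((cell_subset_iff hz).1 H.le)

theorem dirs_mono {z y : E3} (H : h.active y ⊆ h.active z) : h.dirs z ≤ h.dirs y :=
  fun _ hu i hi => hu i (H hi)

theorem dirs_eq_of_active_eq {z y : E3} (H : h.active z = h.active y) : h.dirs z = h.dirs y :=
  le_antisymm (dirs_mono H.ge) (dirs_mono H.le)

theorem sub_mem_dirs {z x : E3} (hx : h.active z ⊆ h.active x) : x - z ∈ h.dirs z := by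
  intro i hi
  rw [inner_sub_eq, mem_active.1 hi, mem_active.1 (hx hi), sub_zero]

/-- Small steps along a direction of the tangent cone stay in the polyhedron, and the inequalities
active afterwards are those whose normals are orthogonal to the direction. -/
theorem eventually_step {z w : E3} (hz : z ∈ P.carrier)
    (hw : ∀ i ∈ h.active z, 0 ≤ ⟪h.normal i, w⟫_ℝ) :
    ∀ᶠ ε in 𝓝[>] (0 : ℝ), z + ε • w ∈ P.carrier ∧
      h.active (z + ε • w) = {i | i ∈ h.active z ∧ ⟪h.normal i, w⟫_ℝ = 0} := by
  have := h.finite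
  -- Inactive inequalities are strict at z, and finitely many strict inequalities survive a small
  -- step.
  have key : ∀ᶠ ε in 𝓝[>] (0 : ℝ), ∀ i, i ∉ h.active z → 0 < h.val i (z + ε • w) := by
    rw [Filter.eventually_all]
    intro i
    by_cases hi : i ∈ h.active z
    · exact Filter.Eventually.of_forall fun _ hn => absurd hi hn
    have hc : Continuous fun ε : ℝ => h.val i (z + ε • w) := by
      simp only [val_add_smul]; fun_prop
    have : ∀ᶠ ε in 𝓝 (0 : ℝ), 0 < h.val i (z + ε • w) := by
      refine hc.continuousAt.eventually (lt_mem_nhds ?_)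
      simpa using val_pos hz hi
    filter_upwards [nhdsWithin_le_nhds this] with ε hε _ using hε
  filter_upwards [key, self_mem_nhdsWithin] with ε hε hpos
  have hpos : 0 < ε := hpos
  refine ⟨h.mem_carrier.2 fun i => ?_, ?_⟩
  · by_cases hi : i ∈ h.active z
    · rw [val_add_smul, mem_active.1 hi, zero_add]
      exact mul_nonneg hpos.le (hw i hi)
    · exact (hε i hi).le
  · ext i
    rw [Set.mem_ofPred_eq]
    by_cases hi : i ∈ h.active z
    · rw [mem_active, val_add_smul, mem_active.1 hi, zero_add]
      simp [hi, hpos.ne']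
    · simp only [hi, false_and, iff_false]
      exact (hε i hi).ne'

theorem exists_step {z w : E3} (hz : z ∈ P.carrier)
    (hw : ∀ i ∈ h.active z, 0 ≤ ⟪h.normal i, w⟫_ℝ) :
    ∃ ε : ℝ, 0 < ε ∧ z + ε • w ∈ P.carrier ∧
      h.active (z + ε • w) = {i | i ∈ h.active z ∧ ⟪h.normal i, w⟫_ℝ = 0} := by
  obtain ⟨ε, h1, h2⟩ := ((eventually_step hz hw).and self_mem_nhdsWithin).exists
  exact ⟨ε, h2, h1⟩

/-- A ray in a nonzero direction leaves the polyhedron. -/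
theorem exists_exit {z w : E3} (hz : z ∈ P.carrier) (hw : w ≠ 0) :
    ∃ t : ℝ, 0 ≤ t ∧ z + t • w ∈ P.carrier ∧
      ∃ i ∈ h.active (z + t • w), ⟪h.normal i, w⟫_ℝ < 0 := by
  have := h.finite
  have hne : ∃ i, ⟪h.normal i, w⟫_ℝ < 0 := by
    by_contra! hcon
    have hray : ∀ t : ℝ, 0 ≤ t → z + t • w ∈ P.carrier := by
      intro t ht
      refine h.mem_carrier.2 fun i => ?_
      rw [val_add_smul]
      have h1 := h.mem_carrier.1 hz i
      have h2 := hcon i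
      positivity
    obtain ⟨R, hR⟩ := P.isBounded.exists_norm_le
    have hwn : 0 < ‖w‖ := norm_pos_iff.2 hw
    have hR0 : 0 ≤ R := (norm_nonneg z).trans (hR z hz)
    -- At this time the displacement has length R + ‖z‖ + 1, which exceeds the distance between z
    -- and any point of norm at most R.
    have h1 := hR _ (hray ((R + ‖z‖ + 1) / ‖w‖) (by positivity))
    have h2 : ‖((R + ‖z‖ + 1) / ‖w‖) • w‖ = R + ‖z‖ + 1 := by
      rw [norm_smul, Real.norm_of_nonneg (by positivity)]
      field_simp
    have h3 := norm_sub_le (z + ((R + ‖z‖ + 1) / ‖w‖) • w) z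
    rw [add_sub_cancel_left, h2] at h3
    linarith
  obtain ⟨t, ht, h1, i, hi, h2⟩ := exists_exit_time (h.mem_carrier.1 hz) hne
  exact ⟨t, ht, h.mem_carrier.2 fun i => by rw [val_add_smul]; exact h1 i, i,
    by rw [mem_active, val_add_smul]; exact h2, hi⟩

/-- The midpoint of two points of the polyhedron. -/
theorem active_midpoint {x y : E3} (hx : x ∈ P.carrier) (hy : y ∈ P.carrier) :
    x + (1 / 2 : ℝ) • (y - x) ∈ P.carrier ∧
      h.active (x + (1 / 2 : ℝ) • (y - x)) = h.active x ∩ h.active y := by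
  have hv : ∀ i, h.val i (x + (1 / 2 : ℝ) • (y - x)) = (h.val i x + h.val i y) / 2 := by
    intro i; rw [val_add_smul, inner_sub_eq]; ring
  refine ⟨h.mem_carrier.2 fun i => ?_, ?_⟩
  · rw [hv]; linarith [h.mem_carrier.1 hx i, h.mem_carrier.1 hy i]
  · ext i
    rw [Set.mem_inter_iff, mem_active, mem_active, mem_active, hv]
    have := h.mem_carrier.1 hx i
    have := h.mem_carrier.1 hy i
    constructor
    · intro H; constructor <;> linarith
    · rintro ⟨H1, H2⟩; linarith

/-- In a nonempty midpoint-closed part of the polyhedron some point has the fewest active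
inequalities. -/
theorem exists_active_min {G : Set E3} (hG : G ⊆ P.carrier) (hne : G.Nonempty)
    (hmid : ∀ x ∈ G, ∀ y ∈ G, x + (1 / 2 : ℝ) • (y - x) ∈ G) :
    ∃ z ∈ G, ∀ x ∈ G, h.active z ⊆ h.active x := by
  have := h.finite
  obtain ⟨_, ⟨z, hz, rfl⟩, hmin⟩ := (Set.toFinite (h.active '' G)).exists_minimal
    (hne.image _)
  refine ⟨z, hz, fun x hx => ?_⟩
  -- A midpoint has as active set the intersection of the two active sets, so a minimal active set
  -- is contained in all the others.
  have h1 := (active_midpoint (h := h) (hG hz) (hG hx)).2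
  have h2 := hmin (Set.mem_image_of_mem _ (hmid z hz x hx)) (by rw [h1]; exact Set.inter_subset_left)
  exact fun i hi => ((h1 ▸ h2) hi).2

theorem _root_.ConvexPolyhedron.carrier_nonempty (P : ConvexPolyhedron) : P.carrier.Nonempty := by
  by_contra H
  rw [Set.not_nonempty_iff_eq_empty] at H
  obtain ⟨K, -⟩ := ConvexPolyhedron.exists_plane_of_collinear (collinear_empty ℝ E3)
  exact P.not_subset_plane K (by rw [H]; exact Set.empty_subset _)

/-- An inequality active at a point with the fewest active ones would be an equality on all of P,
which would put P in a plane. -/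
theorem exists_interior (h : HalfSpaceRep P) : ∃ o ∈ P.carrier, ∀ i, 0 < h.val i o := by
  obtain ⟨o, ho, hmin⟩ := exists_active_min (h := h) subset_rfl P.carrier_nonempty
    fun x hx y hy => (active_midpoint (h := h) hx hy).1
  refine ⟨o, ho, fun i => val_pos ho fun hi => ?_⟩
  refine P.not_subset_plane (Plane.mk ⟨(h.normal i, - h.offset i), h.normal_ne i⟩) fun p hp => ?_
  have := hmin p hp hi
  rw [mem_active, val] at this
  change _ = _
  linarith

/-- A small step along `dirs z` stays in the cell, so the dimension of a cell is the rank of a space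
given by linear equations. -/
theorem vectorSpan_cell {z : E3} (hz : z ∈ P.carrier) : vectorSpan ℝ (h.cell z) = h.dirs z := by
  apply le_antisymm
  · rw [vectorSpan_eq_span_vsub_set_right ℝ (mem_cell_self hz), Submodule.span_le]
    rintro _ ⟨x, hx, rfl⟩
    exact sub_mem_dirs hx.2
  · intro u hu
    obtain ⟨ε, hε, h1, h2⟩ := exists_step hz fun i hi => (mem_dirs.1 hu i hi).ge
    have h3 : z + ε • u ∈ h.cell z := ⟨h1, by
      rw [h2]; exact fun i hi => ⟨hi, mem_dirs.1 hu i hi⟩⟩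
    have h4 := vsub_mem_vectorSpan ℝ h3 (mem_cell_self hz)
    simp only [vsub_eq_sub, add_sub_cancel_left] at h4
    have := Submodule.smul_mem _ ε⁻¹ h4
    rwa [smul_smul, inv_mul_cancel₀ hε.ne', one_smul] at this

theorem collinear_cell_iff {z : E3} (hz : z ∈ P.carrier) :
    Collinear ℝ (h.cell z) ↔ Module.finrank ℝ (h.dirs z) ≤ 1 := by
  rw [collinear_iff_finrank_le_one, vectorSpan_cell hz]

theorem cell_subsingleton_iff {z : E3} (hz : z ∈ P.carrier) :
    (h.cell z).Subsingleton ↔ h.dirs z = ⊥ := by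
  rw [← vectorSpan_cell hz, vectorSpan_eq_bot_iff_subsingleton]

theorem finrank_dirs_le {z : E3} (hz : (h.active z).Nonempty) :
    Module.finrank ℝ (h.dirs z) ≤ 2 := by
  obtain ⟨i, hi⟩ := hz
  have hlt : h.dirs z < ⊤ := by
    rw [lt_top_iff_ne_top]
    intro H
    have : h.normal i ∈ h.dirs z := H ▸ Submodule.mem_top
    have := mem_dirs.1 this i hi
    rw [inner_self_eq_zero] at this
    exact h.normal_ne i this
  have := Submodule.finrank_lt hlt.ne
  have h3 : Module.finrank ℝ E3 = 3 := by simp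
  omega

theorem dirs_eq_top {z : E3} (hz : ¬ (h.active z).Nonempty) : h.dirs z = ⊤ :=
  eq_top_iff.2 fun _ _ i hi => (hz ⟨i, hi⟩).elim

theorem active_nonempty {z : E3} (hz : Module.finrank ℝ (h.dirs z) ≤ 2) :
    (h.active z).Nonempty := by
  by_contra H
  rw [dirs_eq_top H, finrank_top] at hz
  simp at hz

/-- The cell of a boundary point is a planar section. -/
theorem cell_isSection {z : E3} (hne : (h.active z).Nonempty) :
    (∃ H, IsClosedHalfSpace H ∧ h.cell z = P.carrier ∩ H) ∧ ∃ K : Plane, h.cell z ⊆ K.1 := by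
  classical
  have := h.finite
  have := Fintype.ofFinite h.ι
  set A : Finset h.ι := Finset.univ.filter (· ∈ h.active z) with hA
  have hmemA : ∀ i, i ∈ A ↔ i ∈ h.active z := by simp [hA]
  -- The sum of the active inequalities is nonnegative on P and vanishes exactly on the cell, so it
  -- supplies both the half-space and the plane. It is not constant: it is zero at z and positive at
  -- an interior point.
  have hsum : ∀ p, ⟪∑ i ∈ A, h.normal i, p⟫_ℝ + ∑ i ∈ A, h.offset i = ∑ i ∈ A, h.val i p := by
    intro p; rw [sum_inner, ← Finset.sum_add_distrib]; rfl
  obtain ⟨o, ho, hopos⟩ := h.exists_interior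
  have hAne : A.Nonempty := hne.imp fun i hi => (hmemA i).2 hi
  have hn : ∑ i ∈ A, h.normal i ≠ 0 := by
    intro H
    have h1 := hsum o
    have h2 := hsum z
    rw [H, inner_zero_left] at h1 h2
    have h3 : 0 < ∑ i ∈ A, h.val i o := Finset.sum_pos (fun i _ => hopos i) hAne
    have h4 : ∑ i ∈ A, h.val i z = 0 := Finset.sum_eq_zero fun i hi => (hmemA i).1 hi
    linarith
  have hzero : ∀ p ∈ P.carrier, (h.active z ⊆ h.active p ↔ ∑ i ∈ A, h.val i p = 0) := by
    intro p hp
    rw [Finset.sum_eq_zero_iff_of_nonneg fun i _ => h.mem_carrier.1 hp i]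
    exact forall_congr' fun i => by rw [hmemA]; rfl
  refine ⟨⟨{p | 0 ≤ ⟪-∑ i ∈ A, h.normal i, p⟫_ℝ + -∑ i ∈ A, h.offset i},
    ⟨_, _, neg_ne_zero.2 hn, rfl⟩, ?_⟩,
    Plane.mk ⟨(∑ i ∈ A, h.normal i, -∑ i ∈ A, h.offset i), hn⟩, ?_⟩
  · ext p
    refine and_congr_right fun hp => ?_
    rw [hzero p hp, Set.mem_ofPred_eq, inner_neg_left, ← neg_add, hsum, neg_nonneg]
    have : 0 ≤ ∑ i ∈ A, h.val i p := Finset.sum_nonneg fun i _ => h.mem_carrier.1 hp i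
    constructor
    · exact le_of_eq
    · intro H; exact le_antisymm H this
  · rintro p ⟨hp, hpA⟩
    have := hsum p
    rw [(hzero p hp).1 hpA] at this
    change _ = _
    linarith

/-- Every nonempty planar section is a cell. -/
theorem exists_eq_cell (h : HalfSpaceRep P) {G : Set E3}
    (hH : ∃ H, IsClosedHalfSpace H ∧ G = P.carrier ∩ H) (hK : ∃ K : Plane, G ⊆ K.1)
    (hne : G.Nonempty) : ∃ z ∈ P.carrier, (h.active z).Nonempty ∧ G = h.cell z := by
  obtain ⟨_, ⟨n, d, -, rfl⟩, rfl⟩ := hH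
  obtain ⟨K, hK⟩ := hK
  have lin : ∀ (n : E3) (d : ℝ) (y p : E3) (t : ℝ),
      ⟪n, y + t • (p - y)⟫_ℝ + d = (1 - t) * (⟪n, y⟫_ℝ + d) + t * (⟪n, p⟫_ℝ + d) := by
    intro n d y p t
    rw [inner_add_right, real_inner_smul_right, inner_sub_right]
    ring
  -- If y were strictly inside the half-space, a short step from y towards any p in P would stay in
  -- the section, hence in K; this would force p into K.
  have supp : ∀ y ∈ P.carrier, ⟪n, y⟫_ℝ + d ≤ 0 := by
    intro y hy
    by_contra! hpos
    refine P.not_subset_plane K fun p hp => ?_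
    have h1 := eventually_step (h := h) (w := p - y) hy fun i hi => by
      rw [inner_sub_eq, mem_active.1 hi, sub_zero]; exact h.mem_carrier.1 hp i
    have h2 : ∀ᶠ ε in 𝓝 (0 : ℝ), 0 < ⟪n, y + ε • (p - y)⟫_ℝ + d := by
      have hc : Continuous fun ε : ℝ => ⟪n, y + ε • (p - y)⟫_ℝ + d := by fun_prop
      refine hc.continuousAt.eventually (lt_mem_nhds ?_)
      simpa using hpos
    obtain ⟨ε, ⟨⟨h1, -⟩, h2⟩, h3⟩ :=
      ((h1.and (nhdsWithin_le_nhds h2)).and self_mem_nhdsWithin).exists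
    have h3 : 0 < ε := h3
    have hyK : y ∈ K.1 := hK ⟨hy, hpos.le⟩
    have hqK : y + ε • (p - y) ∈ K.1 := hK ⟨h1, h2.le⟩
    obtain ⟨K, n', d', hn', rfl⟩ := K
    have e1 : ⟪n', y⟫_ℝ = d' := hyK
    have e2 : ⟪n', y + ε • (p - y)⟫_ℝ = d' := hqK
    have e3 := lin n' (-d') y p ε
    rw [e1, e2] at e3
    have e4 : ε * (⟪n', p⟫_ℝ + -d') = 0 := by linarith
    rcases mul_eq_zero.1 e4 with e | e
    · exact absurd e h3.ne'
    · change _ = _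
      linarith
  obtain ⟨z, hz, hmin⟩ := exists_active_min (h := h) Set.inter_subset_left hne (by
    rintro x ⟨hx, hx'⟩ y ⟨hy, hy'⟩
    refine ⟨(active_midpoint (h := h) hx hy).1, ?_⟩
    rw [Set.mem_ofPred_eq] at hx' hy' ⊢
    rw [lin]; linarith)
  have hcell : P.carrier ∩ {p | 0 ≤ ⟪n, p⟫_ℝ + d} = h.cell z := by
    refine Set.Subset.antisymm (fun x hx => ⟨hx.1, hmin x hx⟩) fun x hx => ⟨hx.1, ?_⟩
    have h1 := sub_mem_dirs hx.2
    -- The point z is in the relative interior of its cell, so the segment from x can be prolonged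
    -- beyond z. If x were outside the half-space, the prolonged point would be strictly inside,
    -- against `supp`.
    obtain ⟨ε, hε, h2, -⟩ := exists_step hz.1 (w := z - x) fun i hi => by
      have := mem_dirs.1 (Submodule.neg_mem _ h1) i hi
      rw [neg_sub] at this
      exact this.ge
    have h3 := supp _ h2
    have h4 := hz.2
    rw [Set.mem_ofPred_eq] at h4 ⊢
    rw [inner_add_right, real_inner_smul_right, inner_sub_right] at h3
    have h5 := supp z hz.1
    by_contra! h6
    nlinarith
  refine ⟨z, hz.1, ?_, hcell⟩
  by_contra H
  rw [Set.not_nonempty_iff_eq_empty] at H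
  refine P.not_subset_plane K fun p hp => hK ?_
  rw [hcell]
  exact ⟨hp, by rw [H]; exact Set.empty_subset _⟩

/-- This and the two analogues for edges and faces replace supporting half-spaces by linear algebra:
the three kinds of face are the cells with `dirs` of rank 0, 1 and 2. -/
theorem mem_vertices_iff (h : HalfSpaceRep P) {v : E3} :
    v ∈ P.vertices ↔ v ∈ P.carrier ∧ h.dirs v = ⊥ := by
  constructor
  · rintro ⟨H, hH, hv⟩
    obtain ⟨z, hz, -, hcell⟩ := h.exists_eq_cell ⟨H, hH, rfl⟩
      (ConvexPolyhedron.exists_plane_of_collinear (by rw [hv]; exact collinear_singleton ℝ v))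
      (by rw [hv]; exact Set.singleton_nonempty v)
    rw [hv] at hcell
    obtain rfl : z = v := by simpa using hcell.ge (mem_cell_self hz)
    refine ⟨hz, (cell_subsingleton_iff hz).1 ?_⟩
    rw [← hcell]
    exact Set.subsingleton_singleton
  · rintro ⟨hv, hd⟩
    obtain ⟨⟨H, hH, hc⟩, -⟩ := cell_isSection (h := h)
      (active_nonempty (by rw [hd, finrank_bot]; omega))
    refine ⟨H, hH, ?_⟩
    rw [← hc]
    exact ((cell_subsingleton_iff hv).2 hd).eq_singleton_of_mem (mem_cell_self hv)

theorem mem_edges_iff (h : HalfSpaceRep P) {e : Set E3} :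
    e ∈ P.edges ↔ ∃ z ∈ P.carrier, Module.finrank ℝ (h.dirs z) = 1 ∧ e = h.cell z := by
  constructor
  · rintro ⟨hH, hc, hn⟩
    obtain ⟨z, hz, -, rfl⟩ := h.exists_eq_cell hH
      (ConvexPolyhedron.exists_plane_of_collinear hc) hn.nonempty
    refine ⟨z, hz, le_antisymm ((collinear_cell_iff hz).1 hc) ?_, rfl⟩
    rw [Nat.one_le_iff_ne_zero, Ne, Submodule.finrank_eq_zero, ← cell_subsingleton_iff hz]
    exact Set.not_subsingleton_iff.2 hn
  · rintro ⟨z, hz, hd, rfl⟩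
    refine ⟨(cell_isSection (active_nonempty (by omega))).1, (collinear_cell_iff hz).2 hd.le, ?_⟩
    rw [← Set.not_subsingleton_iff, cell_subsingleton_iff hz, ← Submodule.finrank_eq_zero (R := ℝ), hd]
    exact one_ne_zero

theorem mem_faces_iff (h : HalfSpaceRep P) {f : Set E3} :
    f ∈ P.faces ↔ ∃ z ∈ P.carrier, Module.finrank ℝ (h.dirs z) = 2 ∧ f = h.cell z := by
  constructor
  · rintro ⟨hH, hK, hn⟩
    have hne : f.Nonempty := by
      rw [Set.nonempty_iff_ne_empty]
      rintro rfl
      exact hn (collinear_empty ℝ E3)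
    obtain ⟨z, hz, ha, rfl⟩ := h.exists_eq_cell hH hK hne
    refine ⟨z, hz, le_antisymm (finrank_dirs_le ha) ?_, rfl⟩
    rw [collinear_cell_iff hz] at hn
    omega
  · rintro ⟨z, hz, hd, rfl⟩
    have := cell_isSection (active_nonempty hd.le)
    refine ⟨this.1, this.2, ?_⟩
    rw [collinear_cell_iff hz]
    omega

end HalfSpaceRep

/-! ### Two-dimensional cones -/

/-- A cone given by finitely many linear inequalities, of codimension two modulo its lineality
space and with a strictly feasible point, has exactly two facets; here facets are identified with
their sets of active inequalities. -/
theorem exists_two_facets {ι : Type*} [Finite ι] (N : ι → E3) {E K : Submodule ℝ E3}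
    (hKE : K ≤ E) (hK : ∀ w ∈ E, w ∈ K ↔ ∀ i, ⟪N i, w⟫_ℝ = 0)
    (hrank : Module.finrank ℝ E = Module.finrank ℝ K + 2)
    {p : E3} (hpE : p ∈ E) (hp : ∀ i, 0 < ⟪N i, p⟫_ℝ) :
    ∃ r₁ ∈ E, ∃ r₂ ∈ E, (∀ i, 0 ≤ ⟪N i, r₁⟫_ℝ) ∧ (∀ i, 0 ≤ ⟪N i, r₂⟫_ℝ) ∧
      (∃ i, ⟪N i, r₁⟫_ℝ = 0) ∧ (∃ i, ⟪N i, r₂⟫_ℝ = 0) ∧ r₁ ∉ K ∧ r₂ ∉ K ∧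
      (∀ i, ⟪N i, r₁⟫_ℝ = 0 → ⟪N i, r₂⟫_ℝ ≠ 0) ∧
      ∀ w ∈ E, (∀ i, 0 ≤ ⟪N i, w⟫_ℝ) → (∃ i, ⟪N i, w⟫_ℝ = 0) → w ∉ K →
        (∀ i, ⟪N i, w⟫_ℝ = 0 ↔ ⟪N i, r₁⟫_ℝ = 0) ∨ (∀ i, ⟪N i, w⟫_ℝ = 0 ↔ ⟪N i, r₂⟫_ℝ = 0) := by
  have hι : Nonempty ι := by
    by_contra H
    rw [not_nonempty_iff] at H
    have : K = E := le_antisymm hKE fun w hw => (hK w hw).2 fun i => isEmptyElim i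
    rw [this] at hrank
    omega
  have hpK : p ∉ K := fun H => (hp hι.some).ne' ((hK p hpE).1 H _)
  have hsup : K ⊔ ℝ ∙ p ≤ E := sup_le hKE ((Submodule.span_singleton_le_iff_mem _ _).2 hpE)
  have hr1 := Submodule.finrank_sup_span_singleton (K := ℝ) hpK
  obtain ⟨q, hqE, hq⟩ : ∃ q ∈ E, q ∉ K ⊔ ℝ ∙ p := by
    refine SetLike.exists_of_lt (lt_of_le_of_ne hsup fun H => ?_)
    rw [H] at hr1
    omega
  have hr2 := Submodule.finrank_sup_span_singleton (K := ℝ) hq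
  have htop : K ⊔ ℝ ∙ p ⊔ ℝ ∙ q = E :=
    Submodule.eq_of_le_of_finrank_eq
      (sup_le hsup ((Submodule.span_singleton_le_iff_mem _ _).2 hqE)) (by omega)
  have hcomb : ∀ w ∈ E, ∃ a b : ℝ, w - (a • p + b • q) ∈ K := by
    intro w hw
    rw [← htop, Submodule.mem_sup] at hw
    obtain ⟨x, hx, y, hy, rfl⟩ := hw
    obtain ⟨k, hk, z, hz, rfl⟩ := Submodule.mem_sup.1 hx
    obtain ⟨b, rfl⟩ := Submodule.mem_span_singleton.1 hy
    obtain ⟨a, rfl⟩ := Submodule.mem_span_singleton.1 hz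
    exact ⟨a, b, by simpa [add_assoc] using hk⟩
  -- Modulo K the cone lies in the plane with basis p, q. On a • p + b • q the inequality i is a
  -- positive multiple of a + b * s i, so only the extreme slopes matter and each gives one boundary
  -- ray.
  set s : ι → ℝ := fun i => ⟪N i, q⟫_ℝ / ⟪N i, p⟫_ℝ with hs
  have hqs : ∀ i, ⟪N i, q⟫_ℝ = s i * ⟪N i, p⟫_ℝ := fun i => by
    rw [hs]; exact (div_mul_cancel₀ _ (hp i).ne').symm
  obtain ⟨i₁, hmin⟩ := Finite.exists_min s
  obtain ⟨i₂, hmax⟩ := Finite.exists_max s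
  have hnotK : ∀ a b : ℝ, b ≠ 0 → a • p + b • q ∉ K := by
    intro a b hb H
    refine hq ?_
    have : q = b⁻¹ • (a • p + b • q) + (-(b⁻¹ * a)) • p := by
      rw [smul_add, smul_smul, smul_smul, inv_mul_cancel₀ hb, one_smul]
      module
    rw [this]
    exact Submodule.add_mem_sup (K.smul_mem _ H) (Submodule.smul_mem _ _ (Submodule.mem_span_singleton_self p))
  -- If all slopes were equal, q - s i₁ • p would be annihilated by every inequality and lie in K.
  have hlt : s i₁ < s i₂ := by
    refine lt_of_le_of_ne (hmin i₂) fun H => hnotK (-s i₁) 1 one_ne_zero ?_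
    refine (hK _ (E.add_mem (E.smul_mem _ hpE) (E.smul_mem _ hqE))).2 fun i => ?_
    have : s i = s i₁ := le_antisymm ((hmax i).trans H.ge) (hmin i)
    rw [inner_add_right, real_inner_smul_right, real_inner_smul_right, hqs, this]
    ring
  have hval : ∀ (a b : ℝ) i, ⟪N i, a • p + b • q⟫_ℝ = (a + b * s i) * ⟪N i, p⟫_ℝ := by
    intro a b i
    rw [inner_add_right, real_inner_smul_right, real_inner_smul_right, hqs]
    ring
  have hzero : ∀ (a b : ℝ) i, ⟪N i, a • p + b • q⟫_ℝ = 0 ↔ a + b * s i = 0 := by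
    intro a b i
    rw [hval, mul_eq_zero, or_iff_left (hp i).ne']
  have hnonneg : ∀ (a b : ℝ) i, 0 ≤ ⟪N i, a • p + b • q⟫_ℝ ↔ 0 ≤ a + b * s i := by
    intro a b i
    rw [hval, mul_nonneg_iff_of_pos_right (hp i)]
  refine ⟨(-s i₁) • p + (1 : ℝ) • q, E.add_mem (E.smul_mem _ hpE) (E.smul_mem _ hqE),
    s i₂ • p + (-1 : ℝ) • q, E.add_mem (E.smul_mem _ hpE) (E.smul_mem _ hqE),
    fun i => (hnonneg _ _ _).2 (by linarith [hmin i]),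
    fun i => (hnonneg _ _ _).2 (by linarith [hmax i]),
    ⟨i₁, (hzero _ _ _).2 (by ring)⟩, ⟨i₂, (hzero _ _ _).2 (by ring)⟩,
    hnotK _ _ (by norm_num), hnotK _ _ (by norm_num), fun i h1 h2 => ?_, ?_⟩
  · rw [hzero] at h1 h2
    linarith
  · intro w hw hw0 ⟨j, hj⟩ hwK
    obtain ⟨a, b, hab⟩ := hcomb w hw
    have hwi : ∀ i, ⟪N i, w⟫_ℝ = ⟪N i, a • p + b • q⟫_ℝ := by
      intro i
      have := (hK _ (hKE hab)).1 hab i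
      rw [inner_sub_right] at this
      linarith
    simp only [hwi, hzero, hnonneg] at hw0 hj ⊢
    -- The sign of b tells which of the two rays w lies on modulo K; b = 0 forces a = 0, so w would
    -- be in K.
    rcases lt_trichotomy b 0 with hb | hb | hb
    · right
      have h2 : s j = s i₂ := by
        refine le_antisymm (hmax j) ?_
        have := hw0 i₂
        nlinarith
      intro i
      have : a + b * s i = b * (s i - s i₂) := by rw [← h2]; linarith
      rw [this, mul_eq_zero, or_iff_right hb.ne]
      constructor <;> intro H <;> linarith
    · exfalso
      subst hb
      have ha : a = 0 := by simpa using hj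
      subst ha
      exact hwK ((hK w hw).2 fun i => by rw [hwi]; simp)
    · left
      have h2 : s j = s i₁ := by
        refine le_antisymm ?_ (hmin j)
        have := hw0 i₁
        nlinarith
      intro i
      have : a + b * s i = b * (s i - s i₁) := by rw [← h2]; linarith
      rw [this, mul_eq_zero, or_iff_right hb.ne']
      constructor <;> intro H <;> linarith

/-! ### Vertices, edges and connectedness of the edge graph -/

namespace HalfSpaceRep

variable {P : ConvexPolyhedron} {h : HalfSpaceRep P}

theorem finrank_dirs_lt {z y u : E3} (hzy : h.active z ⊆ h.active y) (hu : u ∈ h.dirs z)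
    (hu' : u ∉ h.dirs y) : Module.finrank ℝ (h.dirs y) < Module.finrank ℝ (h.dirs z) :=
  Submodule.finrank_lt_finrank_of_lt (lt_of_le_of_ne (dirs_mono hzy) fun H => hu' (H ▸ hu))

/-- Moving within a cell until the relative boundary is reached. -/
theorem exists_exit_cell {z u : E3} (hz : z ∈ P.carrier) (hu : u ∈ h.dirs z) (hu0 : u ≠ 0) :
    ∃ t : ℝ, 0 < t ∧ z + t • u ∈ P.carrier ∧ h.active z ⊆ h.active (z + t • u) ∧
      ∃ i ∈ h.active (z + t • u), ⟪h.normal i, u⟫_ℝ < 0 := by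
  obtain ⟨t, ht, h1, i, hi, h2⟩ := exists_exit (h := h) hz hu0
  refine ⟨t, lt_of_le_of_ne ht ?_, h1, fun j hj => ?_, i, hi, h2⟩
  · rintro rfl
    rw [zero_smul, add_zero] at hi
    exact h2.ne (mem_dirs.1 hu i hi)
  · rw [mem_active, val_add_smul, mem_active.1 hj, mem_dirs.1 hu j hj]
    ring

theorem exists_exit_cell_finrank {z u : E3} (hz : z ∈ P.carrier) (hu : u ∈ h.dirs z)
    (hu0 : u ≠ 0) :
    ∃ t : ℝ, 0 < t ∧ z + t • u ∈ P.carrier ∧ h.active z ⊆ h.active (z + t • u) ∧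
      Module.finrank ℝ (h.dirs (z + t • u)) < Module.finrank ℝ (h.dirs z) := by
  obtain ⟨t, ht, h1, h2, i, hi, h3⟩ := exists_exit_cell hz hu hu0
  exact ⟨t, ht, h1, h2, finrank_dirs_lt h2 hu fun H => h3.ne (mem_dirs.1 H i hi)⟩

theorem mem_vertices_of_finrank {v : E3} (hv : v ∈ P.carrier)
    (hd : Module.finrank ℝ (h.dirs v) < 1) : v ∈ P.vertices :=
  h.mem_vertices_iff.2 ⟨hv, Submodule.finrank_eq_zero.1 (by omega)⟩

/-- Every linear functional attains its maximum over the polyhedron at a vertex. -/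
theorem exists_vertex_inner_ge (h : HalfSpaceRep P) (c : E3) {z : E3} (hz : z ∈ P.carrier) :
    ∃ v ∈ P.vertices, ⟪c, z⟫_ℝ ≤ ⟪c, v⟫_ℝ := by
  induction hn : Module.finrank ℝ (h.dirs z) using Nat.strong_induction_on generalizing z with
  | _ n ih =>
  by_cases hd : h.dirs z = ⊥
  · exact ⟨z, h.mem_vertices_iff.2 ⟨hz, hd⟩, le_rfl⟩
  -- Moving inside the cell in a direction that does not decrease the functional leads to a cell of
  -- smaller dimension.
  obtain ⟨u, hu, hu0, hcu⟩ : ∃ u ∈ h.dirs z, u ≠ 0 ∧ 0 ≤ ⟪c, u⟫_ℝ := by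
    obtain ⟨u, hu, hu0⟩ := Submodule.exists_mem_ne_zero_of_ne_bot hd
    rcases le_total 0 (⟪c, u⟫_ℝ) with H | H
    · exact ⟨u, hu, hu0, H⟩
    · exact ⟨-u, Submodule.neg_mem _ hu, neg_ne_zero.2 hu0, by rw [inner_neg_right]; linarith⟩
  obtain ⟨t, ht, h1, -, h2⟩ := exists_exit_cell_finrank hz hu hu0
  obtain ⟨v, hv, hle⟩ := ih _ (hn ▸ h2) h1 rfl
  refine ⟨v, hv, le_trans ?_ hle⟩
  rw [inner_add_right, real_inner_smul_right]
  have := mul_nonneg ht.le hcu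
  linarith

/-- The vertices of a convex polyhedron do not lie in a plane. -/
theorem _root_.ConvexPolyhedron.vertices_not_subset_plane (P : ConvexPolyhedron) (K : Plane) :
    ¬ P.vertices ⊆ K.1 := by
  obtain ⟨h⟩ := P.exists_halfSpaceRep
  intro H
  refine P.not_subset_plane K fun p hp => ?_
  -- Vertices with values of the normal functional above and below that at p both lie in K, so p
  -- does too.
  obtain ⟨v, hv, h1⟩ := h.exists_vertex_inner_ge K.2.choose hp
  obtain ⟨w, hw, h2⟩ := h.exists_vertex_inner_ge (-K.2.choose) hp
  obtain ⟨d, -, hd⟩ := K.2.choose_spec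
  have h3 := H hv
  have h4 := H hw
  rw [hd] at h3 h4 ⊢
  have h3 : _ = _ := h3
  have h4 : _ = _ := h4
  rw [inner_neg_left, inner_neg_left] at h2
  change _ = _
  linarith

/-- An edge has exactly two vertices. -/
theorem _root_.ConvexPolyhedron.exists_vertices_of_edge {e : Set E3} (he : e ∈ P.edges) :
    ∃ a b, a ≠ b ∧ ∀ v, (v ∈ P.vertices ∧ v ∈ e) ↔ v = a ∨ v = b := by
  obtain ⟨h⟩ := P.exists_halfSpaceRep
  obtain ⟨z, hz, hd, rfl⟩ := h.mem_edges_iff.1 he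
  obtain ⟨u, hu, hu0⟩ := Submodule.exists_mem_ne_zero_of_ne_bot
    (p := h.dirs z) (by rw [Ne, ← Submodule.finrank_eq_zero (R := ℝ), hd]; exact one_ne_zero)
  have hspan : ∀ w ∈ h.dirs z, ∃ τ : ℝ, w = τ • u := by
    intro w hw
    obtain ⟨τ, hτ⟩ := (finrank_eq_one_iff_of_nonzero' (⟨u, hu⟩ : h.dirs z)
      (by simpa [Subtype.ext_iff] using hu0)).1 hd ⟨w, hw⟩
    exact ⟨τ, by simpa [Subtype.ext_iff] using hτ.symm⟩
  have hend : ∀ u ∈ h.dirs z, u ≠ 0 → ∃ t : ℝ, 0 < t ∧ z + t • u ∈ P.vertices ∧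
      z + t • u ∈ h.cell z ∧ ∃ i ∈ h.active (z + t • u), ⟪h.normal i, u⟫_ℝ < 0 := by
    intro u hu hu0
    obtain ⟨t, ht, h1, h2, i, hi, h3⟩ := exists_exit_cell hz hu hu0
    refine ⟨t, ht, mem_vertices_of_finrank (h := h) h1 ?_, ⟨h1, h2⟩, i, hi, h3⟩
    rw [← hd]
    exact finrank_dirs_lt h2 hu fun H => h3.ne (mem_dirs.1 H i hi)
  obtain ⟨t, ht, htv, htc, i, hi, hiu⟩ := hend u hu hu0
  obtain ⟨s, hs, hsv, hsc, j, hj, hju⟩ := hend (-u) (Submodule.neg_mem _ hu) (neg_ne_zero.2 hu0)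
  have hsn : z + s • -u = z + (-s) • u := by rw [smul_neg, neg_smul]
  rw [hsn] at hsv hsc hj
  rw [inner_neg_right] at hju
  rw [mem_active, val_add_smul] at hi hj
  refine ⟨z + t • u, z + (-s) • u, fun H => ?_, fun v => ⟨?_, ?_⟩⟩
  · have := smul_left_injective ℝ hu0 (add_left_cancel H)
    linarith
  · rintro ⟨hv, hvc⟩
    obtain ⟨hvP, hvd⟩ := h.mem_vertices_iff.1 hv
    obtain ⟨τ, hτ⟩ := hspan _ (sub_mem_dirs hvc.2)
    obtain rfl : v = z + τ • u := by rw [← hτ]; abel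
    -- Some inequality active at the vertex v varies along the edge. It is nonnegative at both ends,
    -- so v cannot lie strictly between them.
    obtain ⟨k, hk, hku⟩ : ∃ k ∈ h.active (z + τ • u), ⟪h.normal k, u⟫_ℝ ≠ 0 := by
      by_contra! H
      have : u ∈ h.dirs (z + τ • u) := H
      rw [hvd] at this
      exact hu0 this
    have e1 := h.mem_carrier.1 hvP i
    have e2 := h.mem_carrier.1 hvP j
    have e3 := h.mem_carrier.1 htc.1 k
    have e4 := h.mem_carrier.1 hsc.1 k
    rw [mem_active] at hk
    rw [val_add_smul] at hk e1 e2 e3 e4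
    rcases lt_or_gt_of_ne hku with hku | hku
    · left
      have : τ = t := le_antisymm (by nlinarith) (by nlinarith)
      rw [this]
    · right
      have : τ = -s := le_antisymm (by nlinarith) (by nlinarith)
      rw [this]
  · rintro (rfl | rfl)
    · exact ⟨htv, htc⟩
    · exact ⟨hsv, hsc⟩

/-- From a vertex that does not maximize a linear functional one can move along an edge to a vertex
with a larger value. -/
theorem _root_.ConvexPolyhedron.exists_edge_improving {v x c : E3} (hv : v ∈ P.vertices)
    (hx : x ∈ P.carrier) (hc : ⟪c, v⟫_ℝ < ⟪c, x⟫_ℝ) :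
    ∃ e ∈ P.edges, v ∈ e ∧ ∃ w ∈ P.vertices, w ∈ e ∧ ⟪c, v⟫_ℝ < ⟪c, w⟫_ℝ := by
  obtain ⟨h⟩ := P.exists_halfSpaceRep
  have := h.finite
  obtain ⟨hvP, hvd⟩ := h.mem_vertices_iff.1 hv
  have hcone : ∀ w, (∀ i ∈ h.active v, 0 ≤ ⟪h.normal i, w⟫_ℝ) → 0 < ⟪c, w⟫_ℝ →
      ∃ z ∈ P.carrier, h.active z = {i | i ∈ h.active v ∧ ⟪h.normal i, w⟫_ℝ = 0} ∧
        ⟪c, v⟫_ℝ < ⟪c, z⟫_ℝ := by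
    intro w hw hcw
    obtain ⟨ε, hε, h1, h2⟩ := exists_step hvP hw
    refine ⟨_, h1, h2, ?_⟩
    rw [inner_add_right, real_inner_smul_right]
    have := mul_pos hε hcw
    linarith
  have hvx : ∀ y ∈ P.carrier, ∀ i ∈ h.active v, 0 ≤ ⟪h.normal i, y - v⟫_ℝ := by
    intro y hy i hi
    rw [inner_sub_eq, mem_active.1 hi, sub_zero]
    exact h.mem_carrier.1 hy i
  -- a cell of least dimension containing the vertex and a better point is an edge
  have main : ∀ n, ∀ z ∈ P.carrier, h.active z ⊆ h.active v → ⟪c, v⟫_ℝ < ⟪c, z⟫_ℝ →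
      Module.finrank ℝ (h.dirs z) = n → ∃ z ∈ P.carrier, h.active z ⊆ h.active v ∧
        ⟪c, v⟫_ℝ < ⟪c, z⟫_ℝ ∧ Module.finrank ℝ (h.dirs z) = 1 := by
    intro n
    induction n using Nat.strong_induction_on with
    | _ n ih =>
    intro z hz hzv hcz hn
    have hzv' : v - z ∈ h.dirs z := sub_mem_dirs hzv
    have hn0 : n ≠ 0 := by
      rintro rfl
      rw [Submodule.finrank_eq_zero] at hn
      rw [hn, Submodule.mem_bot, sub_eq_zero] at hzv'
      rw [hzv'] at hcz
      exact lt_irrefl _ hcz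
    rcases (show n = 1 ∨ 2 ≤ n by omega) with rfl | hn2
    · exact ⟨z, hz, hzv, hcz, hn⟩
    obtain ⟨u, hu, hu0, hcu, i₀, hi₀, hi₀u⟩ : ∃ u ∈ h.dirs z, u ≠ 0 ∧ ⟪c, u⟫_ℝ = 0 ∧
        ∃ i ∈ h.active v, ⟪h.normal i, u⟫_ℝ < 0 := by
      -- In dimension at least two the cell has a direction along which the functional is constant.
      have hex : ∃ u ∈ h.dirs z, u ≠ 0 ∧ ⟪c, u⟫_ℝ = 0 := by
        have h1 := ((innerₗ E3 c).comp (h.dirs z).subtype).finrank_range_add_finrank_ker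
        have h2 : Module.finrank ℝ (LinearMap.range ((innerₗ E3 c).comp (h.dirs z).subtype)) ≤ 1 :=
          (Submodule.finrank_le _).trans (by simp)
        obtain ⟨u, hu, hu0⟩ := Submodule.exists_mem_ne_zero_of_ne_bot
          (p := LinearMap.ker ((innerₗ E3 c).comp (h.dirs z).subtype)) (by
            rw [Ne, ← Submodule.finrank_eq_zero (R := ℝ)]; omega)
        exact ⟨u, u.2, by simpa using hu0, by simpa using hu⟩
      obtain ⟨u, hu, hu0, hcu⟩ := hex
      have : ∃ i ∈ h.active v, ⟪h.normal i, u⟫_ℝ ≠ 0 := by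
        by_contra! H
        have : u ∈ h.dirs v := H
        rw [hvd] at this
        exact hu0 this
      obtain ⟨i, hi, hiu⟩ := this
      rcases lt_or_gt_of_ne hiu with hiu | hiu
      · exact ⟨u, hu, hu0, hcu, i, hi, hiu⟩
      · exact ⟨-u, Submodule.neg_mem _ hu, neg_ne_zero.2 hu0, by rw [inner_neg_right, hcu, neg_zero],
          i, hi, by rw [inner_neg_right]; linarith⟩
    -- The slide takes place in the tangent cone at v rather than in P, so that only inequalities
    -- active at v can stop it. `hcone` then scales the resulting direction back into P, and the new
    -- tight inequality lowers the dimension.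
    obtain ⟨t, ht, h1, ⟨j, hj⟩, h2, h3⟩ := exists_exit_time (ι := h.active v)
      (a := fun i => ⟪h.normal i, z - v⟫_ℝ) (b := fun i => ⟪h.normal i, u⟫_ℝ)
      (fun i => hvx z hz i i.2) ⟨⟨i₀, hi₀⟩, hi₀u⟩
    obtain ⟨z', hz', hact, hcz'⟩ := hcone (z - v + t • u)
      (fun i hi => by rw [inner_add_right, real_inner_smul_right]; exact h1 ⟨i, hi⟩)
      (by rw [inner_add_right, real_inner_smul_right, hcu, inner_sub_right]; linarith)
    have hzz' : h.active z ⊆ h.active z' := by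
      intro i hi
      rw [hact]
      refine ⟨hzv hi, ?_⟩
      rw [inner_add_right, real_inner_smul_right, mem_dirs.1 hu i hi, inner_sub_eq,
        mem_active.1 hi, mem_active.1 (hzv hi)]
      ring
    refine ih _ ?_ z' hz' (by rw [hact]; exact fun i hi => hi.1) hcz' rfl
    rw [← hn]
    refine finrank_dirs_lt hzz' hu fun H => h2.ne (mem_dirs.1 H j ?_)
    rw [hact]
    refine ⟨hj, ?_⟩
    rw [inner_add_right, real_inner_smul_right]
    exact h3
  obtain ⟨z₀, hz₀, hact₀, hcz₀⟩ := hcone (x - v) (hvx x hx) (by rw [inner_sub_right]; linarith)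
  obtain ⟨z, hz, hzv, hcz, hd⟩ := main _ z₀ hz₀ (by rw [hact₀]; exact fun i hi => hi.1) hcz₀ rfl
  refine ⟨h.cell z, h.mem_edges_iff.2 ⟨z, hz, hd, rfl⟩, ⟨hvP, hzv⟩, ?_⟩
  have hu : z - v ∈ h.dirs z := by
    rw [← neg_sub]; exact Submodule.neg_mem _ (sub_mem_dirs hzv)
  -- Continuing from v through z to the end of the edge keeps increasing the functional.
  obtain ⟨t, ht, h1, h2, h3⟩ := exists_exit_cell_finrank hz hu (by
    rintro H
    rw [sub_eq_zero.1 H] at hcz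
    exact lt_irrefl _ hcz)
  refine ⟨_, mem_vertices_of_finrank (h := h) h1 (hd ▸ h3), ⟨h1, h2⟩, ?_⟩
  rw [inner_add_right, real_inner_smul_right, inner_sub_right]
  nlinarith

/-- The edge graph of a convex polyhedron is connected. -/
theorem _root_.ConvexPolyhedron.eq_of_eq_on_edges {X : Type*} (x : E3 → X)
    (hx : ∀ e ∈ P.edges, ∀ v ∈ P.vertices, ∀ w ∈ P.vertices, v ∈ e → w ∈ e → x v = x w)
    {v w : E3} (hv : v ∈ P.vertices) (hw : w ∈ P.vertices) : x v = x w := by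
  by_contra hne
  -- The half-space that isolates w has a normal c maximized over P only at w. Among the vertices
  -- labelled differently from w, one with the largest value of c would have an improving edge to a
  -- vertex with its own label.
  obtain ⟨H, ⟨c, d, -, rfl⟩, hwH⟩ := hw
  have hwm : w ∈ P.carrier ∩ {p | 0 ≤ ⟪c, p⟫_ℝ + d} := by rw [hwH]; rfl
  obtain ⟨a, ⟨ha, haw⟩, hmax⟩ := Set.exists_max_image {a | a ∈ P.vertices ∧ x a ≠ x w}
    (fun a => ⟪c, a⟫_ℝ) (P.finite_vertices.subset fun a ha => ha.1) ⟨v, hv, hne⟩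
  obtain ⟨h⟩ := P.exists_halfSpaceRep
  have hlt : ⟪c, a⟫_ℝ < ⟪c, w⟫_ℝ := by
    by_contra! hle
    have : a ∈ P.carrier ∩ {p | 0 ≤ ⟪c, p⟫_ℝ + d} := by
      refine ⟨(h.mem_vertices_iff.1 ha).1, ?_⟩
      have := hwm.2
      rw [Set.mem_ofPred_eq] at this ⊢
      linarith
    rw [hwH] at this
    exact haw (congrArg x this)
  obtain ⟨e, he, hae, b, hb, hbe, hab⟩ := P.exists_edge_improving ha hwm.1 hlt
  have hxab := hx e he a ha b hb hae hbe
  have := hmax b ⟨hb, fun H => haw (hxab.trans H)⟩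
  exact absurd hab (not_lt.2 this)

end HalfSpaceRep

/-! ### Faces at an edge, edges of a flag, and connectedness of face adjacency -/

namespace HalfSpaceRep

variable {P : ConvexPolyhedron} {h : HalfSpaceRep P}

/-- An edge lies in exactly two faces. -/
theorem _root_.ConvexPolyhedron.exists_faces_of_edge {e : Set E3} (he : e ∈ P.edges) :
    ∃ f₁ f₂, f₁ ≠ f₂ ∧ ∀ f, (f ∈ P.faces ∧ e ⊆ f) ↔ f = f₁ ∨ f = f₂ := by
  obtain ⟨h⟩ := P.exists_halfSpaceRep
  have := h.finite
  obtain ⟨z, hz, hd, rfl⟩ := h.mem_edges_iff.1 he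
  obtain ⟨o, ho, hopos⟩ := h.exists_interior
  -- The tangent cone along the edge has the edge direction as lineality space; its two facets are
  -- the tangent cones of the two faces.
  obtain ⟨r₁, -, r₂, -, hr₁, hr₂, ⟨i₁, hi₁⟩, ⟨i₂, hi₂⟩, hK₁, hK₂, hne, hr⟩ :=
    exists_two_facets (fun i : h.active z => h.normal i) (E := ⊤) (K := h.dirs z) le_top
      (fun w _ => ⟨fun hw i => hw i i.2, fun hw i hi => hw ⟨i, hi⟩⟩) (by rw [hd, finrank_top]; simp)
      (p := o - z) Submodule.mem_top
      (fun i => by rw [inner_sub_eq, mem_active.1 i.2, sub_zero]; exact hopos i)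
  have hface : ∀ r, (∀ i : h.active z, 0 ≤ ⟪h.normal i, r⟫_ℝ) →
      (∃ i : h.active z, ⟪h.normal i, r⟫_ℝ = 0) → r ∉ h.dirs z → ∃ y ∈ P.carrier,
        Module.finrank ℝ (h.dirs y) = 2 ∧
        h.active y = {i | i ∈ h.active z ∧ ⟪h.normal i, r⟫_ℝ = 0} := by
    intro r hr ⟨i, hi⟩ hrK
    obtain ⟨ε, hε, h1, h2⟩ := exists_step hz fun i hi => hr ⟨i, hi⟩
    refine ⟨_, h1, le_antisymm (finrank_dirs_le ⟨i, by rw [h2]; exact ⟨i.2, hi⟩⟩) ?_, h2⟩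
    have : Module.finrank ℝ (h.dirs z) < Module.finrank ℝ (h.dirs (z + ε • r)) :=
      finrank_dirs_lt (u := r) (by rw [h2]; exact fun i hi => hi.1)
        (fun i hi => by rw [h2] at hi; exact hi.2) hrK
    omega
  obtain ⟨y₁, hy₁, hy₁d, hy₁a⟩ := hface r₁ hr₁ ⟨i₁, hi₁⟩ hK₁
  obtain ⟨y₂, hy₂, hy₂d, hy₂a⟩ := hface r₂ hr₂ ⟨i₂, hi₂⟩ hK₂
  refine ⟨h.cell y₁, h.cell y₂, fun H => ?_, fun f => ⟨?_, ?_⟩⟩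
  · have h1 := active_eq_of_cell_eq hy₁ hy₂ H
    have h2 : (i₁ : h.ι) ∈ h.active y₁ := by rw [hy₁a]; exact ⟨i₁.2, hi₁⟩
    rw [h1, hy₂a] at h2
    exact hne i₁ hi₁ h2.2
  · rintro ⟨hf, hzf⟩
    obtain ⟨y, hy, hyd, rfl⟩ := h.mem_faces_iff.1 hf
    have hyz := (cell_subset_iff hz).1 hzf
    have hin : ∀ i ∈ h.active z, ⟪h.normal i, y - z⟫_ℝ = h.val i y := by
      intro i hi
      rw [inner_sub_eq, mem_active.1 hi, sub_zero]
    obtain ⟨j, hj⟩ := active_nonempty (h := h) hyd.le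
    have hact : ∀ r, (∀ i : h.active z, ⟪h.normal i, y - z⟫_ℝ = 0 ↔ ⟪h.normal i, r⟫_ℝ = 0) →
        h.active y = {i | i ∈ h.active z ∧ ⟪h.normal i, r⟫_ℝ = 0} := by
      intro r hr
      ext i
      constructor
      · intro hi
        exact ⟨hyz hi, (hr ⟨i, hyz hi⟩).1 ((hin i (hyz hi)).trans hi)⟩
      · rintro ⟨hi, hir⟩
        exact (hin i hi).symm.trans ((hr ⟨i, hi⟩).2 hir)
    rcases hr (y - z) Submodule.mem_top (fun i => by rw [hin i i.2]; exact h.mem_carrier.1 hy i)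
      ⟨⟨j, hyz hj⟩, (hin j (hyz hj)).trans hj⟩ (fun H => by
        have : h.dirs y ≤ h.dirs z := dirs_mono fun i hi =>
          (hin i hi).symm.trans (mem_dirs.1 H i hi)
        have := Submodule.finrank_mono this
        omega) with H | H
    · left
      exact cell_eq_of_active_eq ((hact _ H).trans hy₁a.symm)
    · right
      exact cell_eq_of_active_eq ((hact _ H).trans hy₂a.symm)
  · rintro (rfl | rfl)
    · exact ⟨h.mem_faces_iff.2 ⟨y₁, hy₁, hy₁d, rfl⟩,
        (cell_subset_iff hz).2 (by rw [hy₁a]; exact fun i hi => hi.1)⟩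
    · exact ⟨h.mem_faces_iff.2 ⟨y₂, hy₂, hy₂d, rfl⟩,
        (cell_subset_iff hz).2 (by rw [hy₂a]; exact fun i hi => hi.1)⟩

/-- At each of its vertices a face has exactly two edges. -/
theorem _root_.ConvexPolyhedron.exists_edges_of_flag {v : E3} {f : Set E3} (hv : v ∈ P.vertices)
    (hf : f ∈ P.faces) (hvf : v ∈ f) :
    ∃ e₁ e₂, e₁ ≠ e₂ ∧ ∀ e, (e ∈ P.edges ∧ v ∈ e ∧ e ⊆ f) ↔ e = e₁ ∨ e = e₂ := by
  obtain ⟨h⟩ := P.exists_halfSpaceRep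
  have := h.finite
  obtain ⟨hvP, hvd⟩ := h.mem_vertices_iff.1 hv
  obtain ⟨y, hy, hd, rfl⟩ := h.mem_faces_iff.1 hf
  have hyv : h.active y ⊆ h.active v := hvf.2
  have hyvd : y - v ∈ h.dirs y := by
    rw [← neg_sub]; exact Submodule.neg_mem _ (sub_mem_dirs hyv)
  have hin : ∀ x, ∀ i ∈ h.active v, ⟪h.normal i, x - v⟫_ℝ = h.val i x := by
    intro x i hi
    rw [inner_sub_eq, mem_active.1 hi, sub_zero]
  have hKiff : ∀ w ∈ h.dirs y, w ∈ (⊥ : Submodule ℝ E3) ↔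
      ∀ i : (h.active v \ h.active y : Set h.ι), ⟪h.normal i, w⟫_ℝ = 0 := by
    intro w hw
    constructor
    · intro H i
      rw [(Submodule.mem_bot ℝ).1 H, inner_zero_right]
    · intro H
      rw [← hvd]
      intro i hi
      by_cases hiy : i ∈ h.active y
      · exact hw i hiy
      · exact H ⟨i, hi, hiy⟩
  -- The same cone lemma, now inside the plane of the face: only inequalities active at v but not on
  -- the whole face cut the cone, and it is pointed because v is a vertex.
  obtain ⟨r₁, hr₁y, r₂, hr₂y, hr₁, hr₂, ⟨i₁, hi₁⟩, ⟨i₂, hi₂⟩, hK₁, hK₂, hne, hr⟩ :=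
    exists_two_facets (fun i : (h.active v \ h.active y : Set h.ι) => h.normal i)
      (E := h.dirs y) (K := ⊥) bot_le hKiff (by rw [hd, finrank_bot]) hyvd
      (fun i => by rw [hin y i i.2.1]; exact val_pos hy i.2.2)
  have hedge : ∀ r ∈ h.dirs y,
      (∀ i : (h.active v \ h.active y : Set h.ι), 0 ≤ ⟪h.normal i, r⟫_ℝ) →
      (∃ i : (h.active v \ h.active y : Set h.ι), ⟪h.normal i, r⟫_ℝ = 0) →
      r ∉ (⊥ : Submodule ℝ E3) → ∃ z ∈ P.carrier, Module.finrank ℝ (h.dirs z) = 1 ∧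
        h.active z = {i | i ∈ h.active v ∧ ⟪h.normal i, r⟫_ℝ = 0} := by
    intro r hry hr ⟨i, hi⟩ hrK
    obtain ⟨ε, hε, h1, h2⟩ := exists_step hvP (w := r) fun i hi => by
      by_cases hiy : i ∈ h.active y
      · exact (hry i hiy).ge
      · exact hr ⟨i, hi, hiy⟩
    refine ⟨_, h1, le_antisymm ?_ ?_, h2⟩
    · have : Module.finrank ℝ (h.dirs (v + ε • r)) < Module.finrank ℝ (h.dirs y) := by
        refine finrank_dirs_lt (u := y - v) ?_ hyvd fun H => ?_
        · rw [h2]; exact fun j hj => ⟨hyv hj, hry j hj⟩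
        · have h3 := mem_dirs.1 H i (by rw [h2]; exact ⟨i.2.1, hi⟩)
          rw [hin y i i.2.1] at h3
          exact i.2.2 h3
      omega
    · rw [Nat.one_le_iff_ne_zero, Ne, Submodule.finrank_eq_zero]
      intro H
      have : r ∈ h.dirs (v + ε • r) := fun i hi => by rw [h2] at hi; exact hi.2
      exact hrK (H ▸ this)
  obtain ⟨z₁, hz₁, hz₁d, hz₁a⟩ := hedge r₁ hr₁y hr₁ ⟨i₁, hi₁⟩ hK₁
  obtain ⟨z₂, hz₂, hz₂d, hz₂a⟩ := hedge r₂ hr₂y hr₂ ⟨i₂, hi₂⟩ hK₂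
  have hback : ∀ r ∈ h.dirs y, ∀ z ∈ P.carrier, Module.finrank ℝ (h.dirs z) = 1 →
      h.active z = {i | i ∈ h.active v ∧ ⟪h.normal i, r⟫_ℝ = 0} →
      h.cell z ∈ P.edges ∧ v ∈ h.cell z ∧ h.cell z ⊆ h.cell y := by
    intro r hry z hz hzd hza
    refine ⟨h.mem_edges_iff.2 ⟨z, hz, hzd, rfl⟩, ⟨hvP, ?_⟩, (cell_subset_iff hz).2 ?_⟩
    · rw [hza]; exact fun i hi => hi.1
    · rw [hza]; exact fun i hi => ⟨hyv hi, hry i hi⟩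
  refine ⟨h.cell z₁, h.cell z₂, fun H => ?_, fun e => ⟨?_, ?_⟩⟩
  · have h1 := active_eq_of_cell_eq hz₁ hz₂ H
    have h2 : (i₁ : h.ι) ∈ h.active z₁ := by rw [hz₁a]; exact ⟨i₁.2.1, hi₁⟩
    rw [h1, hz₂a] at h2
    exact hne i₁ hi₁ h2.2
  · rintro ⟨he, hve, hey⟩
    obtain ⟨z, hz, hzd, rfl⟩ := h.mem_edges_iff.1 he
    have hyz := (cell_subset_iff hz).1 hey
    have hzv : h.active z ⊆ h.active v := hve.2
    have hzvd : z - v ∈ h.dirs y := by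
      have : z - v = (z - y) + (y - v) := by abel
      rw [this]
      exact Submodule.add_mem _ (sub_mem_dirs hyz) hyvd
    obtain ⟨j, hj, hjy⟩ : ∃ j ∈ h.active z, j ∉ h.active y := by
      by_contra! H
      have := dirs_eq_of_active_eq (hyz.antisymm H)
      rw [this] at hd
      omega
    have hact : ∀ r ∈ h.dirs y, (∀ i : (h.active v \ h.active y : Set h.ι),
        ⟪h.normal i, z - v⟫_ℝ = 0 ↔ ⟪h.normal i, r⟫_ℝ = 0) →
        h.active z = {i | i ∈ h.active v ∧ ⟪h.normal i, r⟫_ℝ = 0} := by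
      intro r hry hr
      ext i
      constructor
      · intro hi
        refine ⟨hzv hi, ?_⟩
        by_cases hiy : i ∈ h.active y
        · exact hry i hiy
        · exact (hr ⟨i, hzv hi, hiy⟩).1 ((hin z i (hzv hi)).trans hi)
      · rintro ⟨hi, hir⟩
        by_cases hiy : i ∈ h.active y
        · exact hyz hiy
        · exact (hin z i hi).symm.trans ((hr ⟨i, hi, hiy⟩).2 hir)
    rcases hr (z - v) hzvd (fun i => by rw [hin z i i.2.1]; exact h.mem_carrier.1 hz i)
      ⟨⟨j, hzv hj, hjy⟩, (hin z j (hzv hj)).trans hj⟩ (fun H => by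
        rw [Submodule.mem_bot, sub_eq_zero] at H
        rw [H, hvd, finrank_bot] at hzd
        omega) with H | H
    · left
      exact cell_eq_of_active_eq ((hact _ hr₁y H).trans hz₁a.symm)
    · right
      exact cell_eq_of_active_eq ((hact _ hr₂y H).trans hz₂a.symm)
  · rintro (rfl | rfl)
    · exact hback _ hr₁y _ hz₁ hz₁d hz₁a
    · exact hback _ hr₂y _ hz₂ hz₂d hz₂a

/-- Both spaces have dimension two. The presentation may be redundant, with several inequalities
active on one face; this shows that any one of them determines the plane of the face. -/
theorem mem_dirs_of_face {y u : E3} {i : h.ι} (hd : Module.finrank ℝ (h.dirs y) = 2)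
    (hi : i ∈ h.active y) : u ∈ h.dirs y ↔ ⟪h.normal i, u⟫_ℝ = 0 := by
  have : Fact (Module.finrank ℝ E3 = 2 + 1) := ⟨by simp⟩
  have hker : h.dirs y = (ℝ ∙ h.normal i)ᗮ := by
    refine Submodule.eq_of_le_of_finrank_eq (fun u hu => ?_) ?_
    · rw [Submodule.mem_orthogonal_singleton_iff_inner_right]
      exact hu i hi
    · rw [hd, Submodule.finrank_orthogonal_span_singleton (n := 2) (h.normal_ne i)]
  rw [hker, Submodule.mem_orthogonal_singleton_iff_inner_right]

/-- A single active inequality determines the affine span of a face. -/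
theorem active_subset_of_face {y x : E3} {i : h.ι} (hd : Module.finrank ℝ (h.dirs y) = 2)
    (hi : i ∈ h.active y) (hx : i ∈ h.active x) : h.active y ⊆ h.active x := by
  have hxy : x - y ∈ h.dirs y := by
    rw [mem_dirs_of_face hd hi, inner_sub_eq, mem_active.1 hi, mem_active.1 hx, sub_zero]
  intro j hj
  have := hxy j hj
  rw [inner_sub_eq, mem_active.1 hj, sub_zero] at this
  exact this

/-- Seen from an interior point, a face other than a target face has a neighbour whose normalized
defining inequality is smaller at a given interior point of the target face. -/
theorem exists_face_improving {o y z : E3} (ho : ∀ i, 0 < h.val i o)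
    (hy : y ∈ P.carrier) (hyd : Module.finrank ℝ (h.dirs y) = 2)
    (hz : z ∈ P.carrier) (hzd : Module.finrank ℝ (h.dirs z) = 2)
    (hne : h.cell y ≠ h.cell z) {i : h.ι} (hi : i ∈ h.active y) :
    ∃ e ∈ P.edges, e ⊆ h.cell y ∧ ∃ f ∈ P.faces, e ⊆ f ∧
      ∀ x ∈ P.carrier, f = h.cell x → ∀ j ∈ h.active x,
        h.val j z / h.val j o < h.val i z / h.val i o := by
  set a := h.val i z / h.val i o with ha
  have hai : h.val i z = a * h.val i o := (div_mul_cancel₀ _ (ho i).ne').symm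
  have hapos : 0 < a := by
    refine div_pos (val_pos hz fun H => hne ?_) (ho i)
    exact cell_eq_of_active_eq ((active_subset_of_face hyd hi H).antisymm
      (active_subset_of_face hzd H hi))
  obtain ⟨k, hk⟩ := active_nonempty (h := h) hzd.le
  -- The direction of motion below vanishes for at most special positions of y, so y is shifted
  -- within its face if necessary. No shift helps only when a = 1, but then a vanishing direction
  -- would mean z = o, while z is on the boundary.
  obtain ⟨y', hy', hyy', hw0⟩ : ∃ y' ∈ P.carrier, h.active y' = h.active y ∧
      (z - o) - (1 - a) • (y' - o) ≠ 0 := by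
    by_cases H : (z - o) - (1 - a) • (y - o) = 0
    · obtain ⟨u, hu, hu0⟩ := Submodule.exists_mem_ne_zero_of_ne_bot
        (p := h.dirs y) (by rw [Ne, ← Submodule.finrank_eq_zero (R := ℝ), hyd]; exact two_ne_zero)
      obtain ⟨ε, hε, h1, h2⟩ := exists_step hy fun i hi => (mem_dirs.1 hu i hi).ge
      refine ⟨_, h1, ?_, fun H' => ?_⟩
      · rw [h2]
        ext j
        exact ⟨fun hj => hj.1, fun hj => ⟨hj, hu j hj⟩⟩
      · have h3 : ((1 - a) * ε) • u = 0 := by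
          have : ((1 - a) * ε) • u = ((z - o) - (1 - a) • (y - o)) -
              ((z - o) - (1 - a) • (y + ε • u - o)) := by module
          rw [this, H, H', sub_zero]
        have h4 : 1 - a = 0 := by simpa [hε.ne', hu0] using h3
        rw [h4, zero_smul, sub_zero, sub_eq_zero] at H
        exact (ho k).ne' (H ▸ hk)
    · exact ⟨y, hy, rfl, H⟩
  rw [← cell_eq_of_active_eq hyy'] at hne ⊢
  rw [← hyy'] at hi
  rw [← dirs_eq_of_active_eq hyy'] at hyd
  clear hyy' hy
  -- The coefficient 1 - a makes w parallel to the face of y'. In the polar body about o this is the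
  -- step along an improving edge, carried out on P itself.
  set w := (z - o) - (1 - a) • (y' - o) with hw
  have hwin : ∀ j, ⟪h.normal j, w⟫_ℝ =
      (h.val j z - h.val j o) - (1 - a) * (h.val j y' - h.val j o) := by
    intro j
    rw [hw, inner_sub_right, real_inner_smul_right, inner_sub_eq, inner_sub_eq]
  have hwd : w ∈ h.dirs y' := by
    rw [mem_dirs_of_face hyd hi, hwin, hai, mem_active.1 hi]
    ring
  obtain ⟨t, ht, hx, hyx, hxd⟩ := exists_exit_cell_finrank hy' hwd hw0
  rw [hyd] at hxd
  obtain ⟨e, he, hey, hxe⟩ : ∃ e ∈ P.edges, e ⊆ h.cell y' ∧ y' + t • w ∈ e := by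
    rcases (show Module.finrank ℝ (h.dirs (y' + t • w)) = 1 ∨
      Module.finrank ℝ (h.dirs (y' + t • w)) < 1 by omega) with H | H
    · exact ⟨_, h.mem_edges_iff.2 ⟨_, hx, H, rfl⟩, (cell_subset_iff hx).2 hyx, mem_cell_self hx⟩
    -- If the exit point is a vertex, either edge of the face through it will do.
    · obtain ⟨e, e', -, hee⟩ := P.exists_edges_of_flag (mem_vertices_of_finrank hx H)
        (h.mem_faces_iff.2 ⟨y', hy', hyd, rfl⟩) ⟨hx, hyx⟩
      obtain ⟨h1, h2, h3⟩ := (hee e).2 (Or.inl rfl)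
      exact ⟨e, h1, h3, h2⟩
  obtain ⟨f, hf, hef, hfy⟩ : ∃ f ∈ P.faces, e ⊆ f ∧ f ≠ h.cell y' := by
    obtain ⟨f₁, f₂, h12, hff⟩ := P.exists_faces_of_edge he
    obtain ⟨h1, h1'⟩ := (hff f₁).2 (Or.inl rfl)
    obtain ⟨h2, h2'⟩ := (hff f₂).2 (Or.inr rfl)
    by_cases H : f₁ = h.cell y'
    · exact ⟨f₂, h2, h2', fun H' => h12 (H.trans H'.symm)⟩
    · exact ⟨f₁, h1, h1', H⟩
  refine ⟨e, he, hey, f, hf, hef, ?_⟩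
  rintro x hxP rfl j hj
  obtain ⟨x', hx', hxd', hcell⟩ := h.mem_faces_iff.1 hf
  have hxd : Module.finrank ℝ (h.dirs x) = 2 := by
    rw [dirs_eq_of_active_eq (active_eq_of_cell_eq hxP hx' hcell), hxd']
  have hvy : 0 < h.val j y' := val_pos hy' fun H => hfy (cell_eq_of_active_eq
    ((active_subset_of_face hxd hj H).antisymm (active_subset_of_face hyd H hj)))
  have hvx : h.val j (y' + t • w) = 0 := (hef hxe).2 hj
  rw [val_add_smul] at hvx
  rw [div_lt_iff₀ (ho j)]
  -- If the ratio for j did not drop, the face of j could be reached only when t * (1 - a) ≥ 1; at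
  -- such a time an inequality k active at z would already be violated.
  by_contra! hle
  have h1 : -(1 - a) * h.val j y' ≤ ⟪h.normal j, w⟫_ℝ := by
    rw [hwin]; nlinarith
  have h2 : 1 ≤ t * (1 - a) := by
    by_contra! H
    have := mul_pos hvy (sub_pos.2 H)
    nlinarith
  have h3 := h.mem_carrier.1 hx k
  rw [val_add_smul, hwin, mem_active.1 hk] at h3
  have h4 := h.mem_carrier.1 hy' k
  have h5 := mul_pos (mul_pos ht hapos) (ho k)
  nlinarith

/-- The adjacency graph of the faces of a convex polyhedron is connected. -/
theorem _root_.ConvexPolyhedron.eq_of_eq_across_edges {X : Type*} (x : Set E3 → X)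
    (hx : ∀ e ∈ P.edges, ∀ f ∈ P.faces, ∀ g ∈ P.faces, e ⊆ f → e ⊆ g → x f = x g)
    {f g : Set E3} (hf : f ∈ P.faces) (hg : g ∈ P.faces) : x f = x g := by
  obtain ⟨h⟩ := P.exists_halfSpaceRep
  have := h.finite
  by_contra hne
  obtain ⟨z, hz, hzd, rfl⟩ := h.mem_faces_iff.1 hg
  obtain ⟨o, -, ho⟩ := h.exists_interior
  obtain ⟨y₀, hy₀, hy₀d, rfl⟩ := h.mem_faces_iff.1 hf
  obtain ⟨i₀, hi₀⟩ := active_nonempty (h := h) hy₀d.le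
  -- The minimum runs over the inequalities active on wrongly labelled faces. The improving
  -- neighbour has the same label and a smaller ratio.
  obtain ⟨i, ⟨y, hy, hyd, hi, hyne⟩, hmin⟩ := Set.exists_min_image
    {i | ∃ y ∈ P.carrier, Module.finrank ℝ (h.dirs y) = 2 ∧ i ∈ h.active y ∧
      x (h.cell y) ≠ x (h.cell z)} (fun i => h.val i z / h.val i o) (Set.toFinite _)
    ⟨i₀, y₀, hy₀, hy₀d, hi₀, hne⟩
  obtain ⟨e, he, hey, f, hf, hef, hlt⟩ := exists_face_improving ho hy hyd hz hzd
    (fun H => hyne (congrArg x H)) hi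
  have hxf := hx e he _ (h.mem_faces_iff.2 ⟨y, hy, hyd, rfl⟩) f hf hey hef
  obtain ⟨y', hy', hyd', rfl⟩ := h.mem_faces_iff.1 hf
  obtain ⟨j, hj⟩ := active_nonempty (h := h) hyd'.le
  have := hmin j ⟨y', hy', hyd', hj, fun H => hyne (hxf.trans H)⟩
  exact absurd (hlt y' hy' rfl j hj) (not_lt.2 this)

end HalfSpaceRep

/-! ### Half of Euler's formula over ℤ/2 -/

section Euler

/-- A sum supported on two points. -/
theorem sum_ite_eq_pair {α : Type*} [Fintype α] {p : α → Prop} [DecidablePred p] {a b : α} (hab : a ≠ b)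
    (hp : ∀ i, p i ↔ i = a ∨ i = b) {M : Type*} [AddCommMonoid M] (x : α → M) :
    ∑ i, (if p i then x i else 0) = x a + x b := by
  classical
  rw [← Finset.sum_filter, ← Finset.sum_pair hab]
  congr 1
  ext i
  simp [hp]

open Classical in
/-- Over `ℤ/2`, an incidence matrix of a connected graph with `n` vertices has rank at least
`n - 1`. -/
theorem card_le_rank_add_one {V E : Type*} [Fintype V] [Fintype E] (r : E → V → Prop)
    (htwo : ∀ e, ∃ a b, a ≠ b ∧ ∀ v, r e v ↔ v = a ∨ v = b)
    (hconn : ∀ x : V → ZMod 2, (∀ e v w, r e v → r e w → x v = x w) → ∀ v w, x v = x w) :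
    Fintype.card V ≤ (Matrix.of fun e v => if r e v then (1 : ZMod 2) else 0).rank + 1 := by
  set A : Matrix E V (ZMod 2) := Matrix.of fun e v => if r e v then (1 : ZMod 2) else 0 with hA
  have hker : Module.finrank (ZMod 2) (LinearMap.ker A.mulVecLin) ≤ 1 := by
    refine finrank_le_one_iff.2 ?_
    -- In characteristic two, x a + x b = 0 means x a = x b. Kernel vectors are thus constant along
    -- edges, hence constant, and the kernel has dimension at most one.
    by_cases hV : Nonempty V
    · obtain ⟨v₀⟩ := hV
      have hx : ∀ x ∈ LinearMap.ker A.mulVecLin, ∀ v, x v = x v₀ := by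
        intro x hx v
        refine hconn x (fun e v w hv hw => ?_) v v₀
        obtain ⟨a, b, hab, hr⟩ := htwo e
        have h1 : (A.mulVec x) e = 0 := congrFun hx e
        have h2 : (A.mulVec x) e = x a + x b := by
          rw [← sum_ite_eq_pair hab hr x]
          exact Finset.sum_congr rfl fun v _ => by simp [hA]
        have h3 : x a = x b := by
          rw [h2] at h1
          rw [← CharTwo.sub_eq_add, sub_eq_zero] at h1
          exact h1
        rcases (hr v).1 hv with rfl | rfl <;> rcases (hr w).1 hw with rfl | rfl <;>
          first | rfl | exact h3 | exact h3.symm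
      by_cases hone : (fun _ => 1 : V → ZMod 2) ∈ LinearMap.ker A.mulVecLin
      · refine ⟨⟨_, hone⟩, fun x => ⟨x.1 v₀, ?_⟩⟩
        ext v
        simp [hx x.1 x.2 v]
      · refine ⟨0, fun x => ⟨0, ?_⟩⟩
        ext v
        rw [hx x.1 x.2 v]
        by_contra H
        have h1 : x.1 v₀ = 1 := Fin.eq_one_of_ne_zero _ fun h0 => H (by rw [h0]; rfl)
        refine hone ?_
        convert x.2 using 1
        ext v
        rw [hx x.1 x.2 v, h1]
    · rw [not_nonempty_iff] at hV
      exact ⟨0, fun x => ⟨0, by ext v; exact hV.elim v⟩⟩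
  have := A.mulVecLin.finrank_range_add_finrank_ker
  rw [Module.finrank_fintype_fun_eq_card] at this
  have h2 : A.rank = Module.finrank (ZMod 2) (LinearMap.range A.mulVecLin) := rfl
  omega

namespace ConvexPolyhedron

open Classical in
/-- One half of Euler's polyhedron formula. -/
theorem card_vertex_add_card_face_le (P : ConvexPolyhedron) :
    Fintype.card P.Vertex + Fintype.card P.Face ≤ P.numEdges + 2 := by
  have : Fintype P.edges := P.finite_edges.fintype
  have hE : P.numEdges = Fintype.card P.edges := by
    rw [numEdges, ← Nat.card_coe_set_eq, Nat.card_eq_fintype_card]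
  set A : Matrix P.edges P.Vertex (ZMod 2) := Matrix.of fun e v => if v.1 ∈ e.1 then 1 else 0
  set B : Matrix P.edges P.Face (ZMod 2) := Matrix.of fun e f => if e.1 ⊆ f.1 then 1 else 0
  have hA : Fintype.card P.Vertex ≤ A.rank + 1 := by
    refine card_le_rank_add_one (fun (e : P.edges) (v : P.Vertex) => v.1 ∈ e.1) (fun e => ?_)
      fun x hx v w => ?_
    · obtain ⟨a, b, hab, h⟩ := P.exists_vertices_of_edge e.2
      refine ⟨⟨a, ((h a).2 (Or.inl rfl)).1⟩, ⟨b, ((h b).2 (Or.inr rfl)).1⟩,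
        by simpa using hab, fun v => ?_⟩
      simpa [Subtype.ext_iff] using h v
    · have := P.eq_of_eq_on_edges (fun u => if hu : u ∈ P.vertices then x ⟨u, hu⟩ else 0)
        (fun e he v hv w hw hve hwe => by simpa [hv, hw] using hx ⟨e, he⟩ ⟨v, hv⟩ ⟨w, hw⟩ hve hwe)
        v.2 w.2
      simpa using this
  have hB : Fintype.card P.Face ≤ B.rank + 1 := by
    refine card_le_rank_add_one (fun (e : P.edges) (f : P.Face) => e.1 ⊆ f.1) (fun e => ?_)
      fun x hx v w => ?_
    · obtain ⟨a, b, hab, h⟩ := P.exists_faces_of_edge e.2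
      refine ⟨⟨a, ((h a).2 (Or.inl rfl)).1⟩, ⟨b, ((h b).2 (Or.inr rfl)).1⟩,
        by simpa using hab, fun v => ?_⟩
      simpa [Subtype.ext_iff] using h v
    · have := P.eq_of_eq_across_edges (fun u => if hu : u ∈ P.faces then x ⟨u, hu⟩ else 0)
        (fun e he v hv w hw hve hwe => by simpa [hv, hw] using hx ⟨e, he⟩ ⟨v, hv⟩ ⟨w, hw⟩ hve hwe)
        v.2 w.2
      simpa using this
  -- The entry at (f, v) counts the edges e with v ∈ e ⊆ f. There are two of them if v lies on f and
  -- none otherwise, and modulo two no orientations are needed.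
  have hBA : B.transpose * A = 0 := by
    ext f v
    simp only [Matrix.mul_apply, Matrix.transpose_apply, Matrix.zero_apply, A, B, Matrix.of_apply]
    have hterm : ∀ e : P.edges, ((if e.1 ⊆ f.1 then 1 else 0) * (if v.1 ∈ e.1 then 1 else 0) :
        ZMod 2) = if v.1 ∈ e.1 ∧ e.1 ⊆ f.1 then 1 else 0 := by
      intro e; split_ifs <;> simp_all
    rw [Finset.sum_congr rfl fun e _ => hterm e]
    by_cases hvf : v.1 ∈ f.1
    · obtain ⟨a, b, hab, h⟩ := P.exists_edges_of_flag v.2 f.2 hvf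
      rw [sum_ite_eq_pair (p := fun e : P.edges => v.1 ∈ e.1 ∧ e.1 ⊆ f.1)
        (a := (⟨a, ((h a).2 (Or.inl rfl)).1⟩ : P.edges))
        (b := ⟨b, ((h b).2 (Or.inr rfl)).1⟩) (by simpa using hab)
        (fun e => by simpa [Subtype.ext_iff] using h e) fun _ => (1 : ZMod 2)]
      exact CharTwo.add_self_eq_zero 1
    · refine Finset.sum_eq_zero fun e _ => if_neg fun H => hvf (H.2 H.1)
  have := Matrix.rank_add_rank_le_card_of_mul_eq_zero hBA
  rw [Matrix.rank_transpose] at this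
  omega

end ConvexPolyhedron

end Euler

/-! ### The space of planes and its coefficient coordinates -/

/-- The foot p of the perpendicular from the origin lies on both planes, so b - a is orthogonal to
a. Then p + (b - a) is also on both planes, which makes b - a orthogonal to b, hence to itself. -/
theorem planeSet_one_injective {a b : E3} (ha : a ≠ 0) (hab : planeSet a 1 = planeSet b 1) :
    a = b := by
  have haa : ⟪a, a⟫_ℝ ≠ 0 := by rwa [Ne, inner_self_eq_zero]
  set p : E3 := (⟪a, a⟫_ℝ)⁻¹ • a with hp
  have hap : ⟪a, p⟫_ℝ = 1 := by rw [hp, real_inner_smul_right, inv_mul_cancel₀ haa]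
  have hmem : ∀ x, ⟪a, x⟫_ℝ = 1 → ⟪b, x⟫_ℝ = 1 := fun x hx => by
    have : x ∈ planeSet a 1 := hx
    rwa [hab] at this
  have hbp := hmem p hap
  have h1 : ⟪a, b - a⟫_ℝ = 0 := by
    have : ⟪b - a, p⟫_ℝ = 0 := by rw [inner_sub_left, hap, hbp, sub_self]
    rw [hp, real_inner_smul_right] at this
    rw [real_inner_comm]
    exact (mul_eq_zero.1 this).resolve_left (inv_ne_zero haa)
  have h2 : ⟪b, b - a⟫_ℝ = 0 := by
    have := hmem (p + (b - a)) (by rw [inner_add_right, hap, h1, add_zero])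
    rw [inner_add_right, hbp] at this
    linarith
  have h3 : ⟪b - a, b - a⟫_ℝ = 0 := by rw [inner_sub_left, h1, h2, sub_self]
  exact (sub_eq_zero.1 (inner_self_eq_zero.1 h3)).symm

namespace Plane

theorem ext {K L : Plane} (hKL : K.1 = L.1) : K = L := Subtype.ext hKL

theorem mem_mk {q : {q : E3 × ℝ // q.1 ≠ 0}} {p : E3} : p ∈ (mk q).1 ↔ ⟪q.1.1, p⟫_ℝ = q.1.2 :=
  Iff.rfl

theorem zero_mem_mk {q : {q : E3 × ℝ // q.1 ≠ 0}} : (0 : E3) ∈ (mk q).1 ↔ q.1.2 = 0 := by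
  rw [mem_mk, inner_zero_right, eq_comm]

theorem mk_surjective : Function.Surjective mk := by
  rintro ⟨K, n, d, hn, rfl⟩
  exact ⟨⟨(n, d), hn⟩, rfl⟩

theorem coeff_ne_zero {K : Plane} (hK : (0 : E3) ∉ K.1) : K.coeff ≠ 0 := by
  intro H
  have h1 := K.eq_planeSet_coeff hK
  obtain ⟨⟨⟨n, d⟩, hn⟩, rfl⟩ := mk_surjective K
  have h2 : d • (⟪n, n⟫_ℝ)⁻¹ • n ∈ (mk ⟨(n, d), hn⟩).1 := by
    rw [mem_mk, real_inner_smul_right, real_inner_smul_right,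
      inv_mul_cancel₀ (by simpa using hn), mul_one]
  rw [h1, H] at h2
  have h3 : _ = _ := h2
  rw [inner_zero_left] at h3
  exact zero_ne_one h3

theorem eq_mk_coeff {K : Plane} (hK : (0 : E3) ∉ K.1) :
    K = mk ⟨(K.coeff, 1), coeff_ne_zero hK⟩ := ext (K.eq_planeSet_coeff hK)

theorem coeff_mk {q : {q : E3 × ℝ // q.1 ≠ 0}} (hq : q.1.2 ≠ 0) :
    (mk q).coeff = q.1.2⁻¹ • q.1.1 := by
  have h0 : (0 : E3) ∉ (mk q).1 := fun H => hq (zero_mem_mk.1 H)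
  refine planeSet_one_injective (coeff_ne_zero h0) ?_
  rw [← (mk q).eq_planeSet_coeff h0]
  ext p
  rw [mem_mk]
  change _ ↔ _ = _
  rw [real_inner_smul_left, inv_mul_eq_one₀ hq, eq_comm]

theorem continuous_mk : Continuous mk := continuous_coinduced_rng

theorem isOpen_zero_notMem : IsOpen {K : Plane | (0 : E3) ∉ K.1} := by
  rw [isOpen_coinduced]
  have : mk ⁻¹' {K : Plane | (0 : E3) ∉ K.1} = {q | q.1.2 ≠ 0} := by
    ext q; exact not_congr zero_mem_mk
  rw [this]
  exact isOpen_ne_fun (by fun_prop) continuous_const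

/-- In the quotient topology, continuity over the open set of planes missing the origin can be
tested on equations, where the coefficient vector is d⁻¹ • n. -/
theorem continuousAt_coeff {K : Plane} (hK : (0 : E3) ∉ K.1) : ContinuousAt coeff K := by
  refine (ContinuousOn.continuousAt (s := {K : Plane | (0 : E3) ∉ K.1}) ?_
    (isOpen_zero_notMem.mem_nhds hK))
  rw [continuousOn_open_iff isOpen_zero_notMem]
  intro O hO
  rw [isOpen_coinduced]
  have hc : ContinuousOn (fun q : {q : E3 × ℝ // q.1 ≠ 0} => q.1.2⁻¹ • q.1.1) {q | q.1.2 ≠ 0} := by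
    refine ContinuousOn.smul (ContinuousOn.inv₀ (by fun_prop) fun q hq => hq) (by fun_prop)
  have hopen : IsOpen {q : {q : E3 × ℝ // q.1 ≠ 0} | q.1.2 ≠ 0} :=
    isOpen_ne_fun (by fun_prop) continuous_const
  convert (continuousOn_open_iff hopen).1 hc O hO using 1
  ext q
  simp only [Set.mem_preimage, Set.mem_inter_iff, Set.mem_ofPred_eq]
  rw [zero_mem_mk]
  exact and_congr_right fun hq => by rw [coeff_mk hq]

theorem map_eq (g : E3 ≃ᵃⁱ[ℝ] E3) (p : E3) : g p = g.linearIsometryEquiv p + g 0 := by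
  have := g.map_vadd (0 : E3) p
  simpa using this

theorem move_mk (g : E3 ≃ᵃⁱ[ℝ] E3) (q : {q : E3 × ℝ // q.1 ≠ 0}) :
    (mk q).move g = mk ⟨(g.linearIsometryEquiv q.1.1, q.1.2 + ⟪g.linearIsometryEquiv q.1.1, g 0⟫_ℝ),
      by simpa using q.2⟩ := by
  refine ext ?_
  have key : ∀ p : E3, ⟪g.linearIsometryEquiv q.1.1, g p⟫_ℝ
      = ⟪q.1.1, p⟫_ℝ + ⟪g.linearIsometryEquiv q.1.1, g 0⟫_ℝ := by
    intro p
    rw [map_eq, inner_add_right, LinearIsometryEquiv.inner_map_map]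
  ext y
  rw [mem_mk]
  constructor
  · rintro ⟨p, hp, rfl⟩
    rw [mem_mk] at hp
    rw [key, hp]
  · intro hy
    refine ⟨g.symm y, ?_, by simp⟩
    have := key (g.symm y)
    rw [AffineIsometryEquiv.apply_symm_apply, hy] at this
    rw [mem_mk]
    exact (add_right_cancel this).symm

end Plane

/-! ### Small isometries and the topology of realizations -/

/-- Pointwise convergence to the identity suffices even for a moving argument, because isometries
preserve the norm of the error a i - a₀. -/
theorem tendsto_linearIsometryEquiv {α : Type*} {l : Filter α} {g : α → E3 ≃ᵃⁱ[ℝ] E3}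
    (hg : ∀ x, Filter.Tendsto (fun i => g i x) l (𝓝 x)) {a : α → E3} {a₀ : E3}
    (ha : Filter.Tendsto a l (𝓝 a₀)) :
    Filter.Tendsto (fun i => (g i).linearIsometryEquiv (a i)) l (𝓝 a₀) := by
  have h1 : Filter.Tendsto (fun i => (g i).linearIsometryEquiv a₀) l (𝓝 a₀) := by
    have := (hg a₀).sub (hg 0)
    simpa [Plane.map_eq _ a₀] using this
  have h2 : Filter.Tendsto (fun i => (g i).linearIsometryEquiv (a i - a₀)) l (𝓝 0) := by
    rw [tendsto_zero_iff_norm_tendsto_zero]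
    simp only [LinearIsometryEquiv.norm_map]
    exact tendsto_zero_iff_norm_tendsto_zero.1 (by simpa using ha.sub_const a₀)
  have h3 := h2.add h1
  simpa only [← map_add, sub_add_cancel, zero_add] using h3

theorem tendsto_map {α : Type*} {l : Filter α} {g : α → E3 ≃ᵃⁱ[ℝ] E3}
    (hg : ∀ x, Filter.Tendsto (fun i => g i x) l (𝓝 x)) {a : α → E3} {a₀ : E3}
    (ha : Filter.Tendsto a l (𝓝 a₀)) : Filter.Tendsto (fun i => g i (a i)) l (𝓝 a₀) := by
  have := (tendsto_linearIsometryEquiv hg ha).add (hg 0)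
  simpa [← Plane.map_eq] using this

/-- Isometries close to the identity are rigid motions. -/
theorem eventually_isRigidMotion {α : Type*} {l : Filter α} {g : α → E3 ≃ᵃⁱ[ℝ] E3}
    (hg : ∀ x, Filter.Tendsto (fun i => g i x) l (𝓝 x)) : ∀ᶠ i in l, IsRigidMotion (g i) := by
  have hlim : Filter.Tendsto (fun i => LinearMap.det
      ((g i).linearIsometryEquiv.toLinearEquiv : E3 →ₗ[ℝ] E3)) l (𝓝 1) := by
    set b := (EuclideanSpace.basisFun (Fin 3) ℝ).toBasis
    have hM : Filter.Tendsto (fun i => LinearMap.toMatrix b b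
        ((g i).linearIsometryEquiv.toLinearEquiv : E3 →ₗ[ℝ] E3)) l (𝓝 1) := by
      rw [← LinearMap.toMatrix_id b]
      refine tendsto_pi_nhds.2 fun j => tendsto_pi_nhds.2 fun k => ?_
      have h1 := tendsto_linearIsometryEquiv hg (tendsto_const_nhds (x := b k))
      have h2 : Continuous fun x : E3 => b.repr x j :=
        (b.coord j).continuous_of_finiteDimensional
      simpa [LinearMap.toMatrix_apply, Function.comp_def] using (h2.tendsto _).comp h1
    have := ((continuous_id.matrix_det (R := ℝ) (n := Fin 3)).tendsto 1).comp hM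
    simpa [Function.comp_def] using this
  -- The determinant is ±1 and tends to 1, so it is eventually 1.
  have habs : ∀ i, |LinearMap.det ((g i).linearIsometryEquiv.toLinearEquiv : E3 →ₗ[ℝ] E3)| = 1 := by
    intro i
    rw [← LinearMap.normDet_eq_abs_det]
    exact (g i).linearIsometryEquiv.toLinearIsometry.normDet_eq_one
  filter_upwards [hlim.eventually (lt_mem_nhds zero_lt_one)] with i hi
  rw [IsRigidMotion, ← habs i, abs_of_pos hi]

namespace Realization

variable {P : ConvexPolyhedron}

theorem ext {Q R : Realization P} (hv : Q.vertex = R.vertex) (hf : Q.face = R.face) : Q = R := by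
  cases Q; cases R; cases hv; cases hf; rfl

theorem tendsto_iff {α : Type*} {l : Filter α} {Q : α → Realization P} {Q₀ : Realization P} :
    Filter.Tendsto Q l (𝓝 Q₀) ↔
      (∀ v, Filter.Tendsto (fun i => (Q i).vertex v) l (𝓝 (Q₀.vertex v))) ∧
      ∀ f, Filter.Tendsto (fun i => (Q i).face f) l (𝓝 (Q₀.face f)) := by
  rw [(Topology.IsInducing.mk rfl : Topology.IsInducing
    fun Q : Realization P => (Q.vertex, Q.face)).tendsto_nhds_iff, Prod.tendsto_iff,
    tendsto_pi_nhds, tendsto_pi_nhds]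
  rfl

theorem eventually_avoidsOrigin {Q₀ : Realization P} (h₀ : Q₀.AvoidsOrigin) :
    ∀ᶠ Q in 𝓝 Q₀, Q.AvoidsOrigin := by
  refine Filter.eventually_all.2 fun f => ?_
  exact ((tendsto_iff.1 Filter.tendsto_id).2 f).eventually (Plane.isOpen_zero_notMem.mem_nhds (h₀ f))

theorem continuousAt_coords {Q₀ : Realization P} (h₀ : Q₀.AvoidsOrigin) :
    ContinuousAt Realization.coords Q₀ := by
  obtain ⟨hv, hf⟩ := tendsto_iff.1 (Filter.tendsto_id (x := 𝓝 Q₀))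
  have hc : ∀ i : Fin 3, Continuous fun x : E3 => x i := fun i => by fun_prop
  refine tendsto_pi_nhds.2 ?_
  rintro ⟨v | f, i⟩
  · exact ((hc i).tendsto _).comp (hv v)
  · exact ((hc i).tendsto _).comp ((Plane.continuousAt_coeff (h₀ f)).tendsto.comp (hf f))

theorem coords_injOn {Q R : Realization P} (hQ : Q.AvoidsOrigin) (hR : R.AvoidsOrigin)
    (h : Q.coords = R.coords) : Q = R := by
  refine ext (funext fun v => ?_) (funext fun f => Plane.ext ?_)
  · ext i
    exact congrFun h (Sum.inl v, i)
  · have : (Q.face f).coeff = (R.face f).coeff := by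
      ext i
      exact congrFun h (Sum.inr f, i)
    rw [(Q.face f).eq_planeSet_coeff (hQ f), (R.face f).eq_planeSet_coeff (hR f), this]

/-- Joint continuity of the action at the identity. It serves both for curves of motions of a fixed
realization and for motions that depend on the realization. -/
theorem tendsto_move {α : Type*} {l : Filter α} {Q : α → Realization P} {Q₀ : Realization P}
    (h₀ : Q₀.AvoidsOrigin) (hQ : Filter.Tendsto Q l (𝓝 Q₀)) {g : α → E3 ≃ᵃⁱ[ℝ] E3}
    (hg : ∀ x, Filter.Tendsto (fun i => g i x) l (𝓝 x)) :
    Filter.Tendsto (fun i => (Q i).move (g i)) l (𝓝 Q₀) := by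
  obtain ⟨hv, hf⟩ := tendsto_iff.1 hQ
  refine tendsto_iff.2 ⟨fun v => tendsto_map hg (hv v), fun f => ?_⟩
  have hlim : Filter.Tendsto (fun i => ((Q i).face f).coeff) l (𝓝 (Q₀.face f).coeff) :=
    (Plane.continuousAt_coeff (h₀ f)).tendsto.comp (hf f)
  have hav : ∀ᶠ i in l, (0 : E3) ∉ ((Q i).face f).1 :=
    (hf f).eventually (Plane.isOpen_zero_notMem.mem_nhds (h₀ f))
  have hR := tendsto_linearIsometryEquiv hg hlim
  classical
  -- the coefficients of the moved planes, as a total function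
  set q₀ : {q : E3 × ℝ // q.1 ≠ 0} := ⟨((Q₀.face f).coeff, 1), Plane.coeff_ne_zero (h₀ f)⟩ with hq₀
  set q : α → {q : E3 × ℝ // q.1 ≠ 0} := fun i =>
    if hi : (0 : E3) ∉ ((Q i).face f).1 then
      ⟨((g i).linearIsometryEquiv ((Q i).face f).coeff,
        1 + ⟪(g i).linearIsometryEquiv ((Q i).face f).coeff, g i 0⟫_ℝ),
        by simpa using Plane.coeff_ne_zero hi⟩
    else q₀ with hq
  have hqlim : Filter.Tendsto q l (𝓝 q₀) := by
    rw [tendsto_subtype_rng]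
    have h1 := hR.prodMk_nhds ((tendsto_const_nhds (x := (1 : ℝ))).add (hR.inner (hg 0)))
    rw [inner_zero_right, add_zero] at h1
    refine h1.congr' ?_
    filter_upwards [hav] with i hi
    simp only [hq, dif_pos hi]
  have h2 := (Plane.continuous_mk.tendsto q₀).comp hqlim
  rw [hq₀, ← Plane.eq_mk_coeff (h₀ f)] at h2
  refine h2.congr' ?_
  filter_upwards [hav] with i hi
  simp only [Function.comp, hq, dif_pos hi]
  change _ = ((Q i).face f).move (g i)
  conv_rhs => rw [Plane.eq_mk_coeff hi, Plane.move_mk]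

theorem phi_coords {Q : Realization P} (hQ : Q.AvoidsOrigin) (q : P.Incidence) :
    phi P q Q.coords = 0 := by
  have h1 := Q.incident q.1.1 q.1.2 q.2
  rw [(Q.face q.1.2).eq_planeSet_coeff (hQ _)] at h1
  have h2 : ⟪(Q.face q.1.2).coeff, Q.vertex q.1.1⟫_ℝ = 1 := h1
  rw [phi, sub_eq_zero, ← h2, PiLp.inner_apply]
  refine Finset.sum_congr rfl fun i _ => ?_
  simp [coords, mul_comm]

end Realization

/-! ### Infinitesimal rigid motions in coordinates -/

namespace Plane

theorem coeff_move {K : Plane} (hK : (0 : E3) ∉ K.1) (g : E3 ≃ᵃⁱ[ℝ] E3)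
    (hg : 1 + ⟪g.linearIsometryEquiv K.coeff, g 0⟫_ℝ ≠ 0) :
    (K.move g).coeff =
      (1 + ⟪g.linearIsometryEquiv K.coeff, g 0⟫_ℝ)⁻¹ • g.linearIsometryEquiv K.coeff := by
  conv_lhs => rw [eq_mk_coeff hK, move_mk]
  rw [coeff_mk hg]

end Plane

/-- A skew-adjoint operator is the velocity of a curve of linear isometries. -/
theorem exists_linearIsometryEquiv_curve {E : Type*} [NormedAddCommGroup E]
    [InnerProductSpace ℝ E] [CompleteSpace E] {A : E →L[ℝ] E}
    (hA : ∀ x y, ⟪A x, y⟫_ℝ = -⟪x, A y⟫_ℝ) :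
    ∃ U : ℝ → E ≃ₗᵢ[ℝ] E, (∀ x, U 0 x = x) ∧ ∀ x, HasDerivAt (fun s => U s x) (A x) 0 := by
  let : NormedAlgebra ℚ (E →L[ℝ] E) := NormedAlgebra.restrictScalars ℚ ℝ _
  have hskew : A ∈ skewAdjoint (E →L[ℝ] E) := by
    rw [skewAdjoint.mem_iff, ContinuousLinearMap.star_eq_adjoint, eq_comm,
      ContinuousLinearMap.eq_adjoint_iff]
    intro x y
    simp [hA]
  -- The curve is the one-parameter group s ↦ exp (s • A), which is unitary because A is skew.
  have hmem : ∀ s : ℝ, NormedSpace.exp (s • A) ∈ unitary (E →L[ℝ] E) := fun s =>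
    NormedSpace.exp_mem_unitary_of_mem_skewAdjoint (skewAdjoint.smul_mem s hskew)
  have h0 : NormedSpace.exp ((0 : ℝ) • A) = 1 := by rw [zero_smul, NormedSpace.exp_zero]
  refine ⟨fun s => Unitary.linearIsometryEquiv ⟨_, hmem s⟩, fun x => ?_, fun x => ?_⟩
  · change NormedSpace.exp ((0 : ℝ) • A) x = x
    rw [h0]
    rfl
  · have h1 := hasDerivAt_exp_smul_const A (0 : ℝ)
    rw [h0, one_mul] at h1
    have h2 : HasDerivAt (fun s : ℝ => NormedSpace.exp (s • A) x) (A x) 0 := by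
      simpa using h1.clm_apply (hasDerivAt_const (0 : ℝ) x)
    exact h2

namespace Realization

variable {P : ConvexPolyhedron}

/-- The velocity of the coordinates of a realization under the infinitesimal motion
`x ↦ A x + τ`. -/
def velocity (Q : Realization P) : (E3 →L[ℝ] E3) × E3 →ₗ[ℝ] CoordSpace P where
  toFun m k := (Sum.elim (fun v => m.1 (Q.vertex v) + m.2)
    (fun f => m.1 (Q.face f).coeff - ⟪(Q.face f).coeff, m.2⟫_ℝ • (Q.face f).coeff) k.1 : E3) k.2
  map_add' m n := by
    ext ⟨v | f, i⟩
    · simp; ring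
    · simp [inner_add_right]; ring
  map_smul' c m := by
    ext ⟨v | f, i⟩
    · simp; ring
    · simp [real_inner_smul_right]; ring

/-- An infinitesimal motion is the velocity of a curve of isometries through the identity. -/
theorem exists_hasDerivAt_coords_move {Q : Realization P} (hQ : Q.AvoidsOrigin)
    {A : E3 →L[ℝ] E3} (hA : ∀ x y, ⟪A x, y⟫_ℝ = -⟪x, A y⟫_ℝ) (τ : E3) :
    ∃ g : ℝ → E3 ≃ᵃⁱ[ℝ] E3, (∀ x, Filter.Tendsto (fun s => g s x) (𝓝 0) (𝓝 x)) ∧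
      (Q.move (g 0)).coords = Q.coords ∧
      HasDerivAt (fun s => (Q.move (g s)).coords) (Q.velocity (A, τ)) 0 := by
  obtain ⟨U, hU0, hU⟩ := exists_linearIsometryEquiv_curve hA
  set g : ℝ → E3 ≃ᵃⁱ[ℝ] E3 := fun s =>
    (U s).toAffineIsometryEquiv.trans (AffineIsometryEquiv.constVAdd ℝ E3 (s • τ)) with hg
  have hgx : ∀ s x, g s x = s • τ + U s x := fun s x => rfl
  have hg0 : ∀ s, g s 0 = s • τ := fun s => by rw [hgx, map_zero, add_zero]
  have hgR : ∀ s x, (g s).linearIsometryEquiv x = U s x := by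
    intro s x
    have := Plane.map_eq (g s) x
    rw [hgx, hg0, add_comm, add_right_cancel_iff] at this
    exact this.symm
  have hsτ : HasDerivAt (fun s : ℝ => s • τ) τ 0 := by
    simpa using (hasDerivAt_id (0 : ℝ)).smul_const τ
  have hvert : ∀ x, HasDerivAt (fun s => g s x) (A x + τ) 0 := by
    intro x
    rw [add_comm]
    exact hsτ.add (hU x)
  have hzero : ∀ x, g 0 x = x := by intro x; rw [hgx, hU0, zero_smul, zero_add]
  have htend : ∀ x, Filter.Tendsto (fun s => g s x) (𝓝 0) (𝓝 x) := by
    intro x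
    simpa [hzero] using (hvert x).continuousAt.tendsto
  have hface : ∀ f, HasDerivAt (fun s => ((Q.face f).move (g s)).coeff)
      (A (Q.face f).coeff - ⟪(Q.face f).coeff, τ⟫_ℝ • (Q.face f).coeff) 0 := by
    intro f
    set a := (Q.face f).coeff with ha
    have h1 : HasDerivAt (fun s : ℝ => 1 + ⟪U s a, s • τ⟫_ℝ) ⟪a, τ⟫_ℝ 0 := by
      refine (((hU a).inner ℝ hsτ).const_add 1).congr_deriv ?_
      rw [hU0, zero_smul, inner_zero_right, add_zero]
    have hval : 1 + ⟪U 0 a, (0 : ℝ) • τ⟫_ℝ = 1 := by rw [zero_smul, inner_zero_right, add_zero]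
    -- The plane ⟪a, x⟫ = 1 moves to ⟪U s a, x⟫ = 1 + ⟪U s a, s • τ⟫; dividing by the right-hand
    -- side produces the quadratic term ⟪a, τ⟫ • a of the velocity.
    have h2 : HasDerivAt (fun s : ℝ => (1 + ⟪U s a, s • τ⟫_ℝ)⁻¹ • U s a)
        (A a - ⟪a, τ⟫_ℝ • a) 0 := by
      refine ((h1.fun_inv (by rw [hval]; exact one_ne_zero)).fun_smul (hU a)).congr_deriv ?_
      rw [hval, hU0, inv_one, one_smul, one_pow, div_one, neg_smul, sub_eq_add_neg]
    refine h2.congr_of_eventuallyEq ?_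
    filter_upwards [h1.continuousAt.eventually_ne (by rw [hval]; exact one_ne_zero)] with s hs
    rw [← hgR, ← hg0] at hs ⊢
    exact Plane.coeff_move (hQ f) (g s) hs
  refine ⟨g, htend, ?_, ?_⟩
  · have h0 : g 0 = AffineIsometryEquiv.refl ℝ E3 := AffineIsometryEquiv.ext hzero
    rw [h0]
    congr 1
    refine ext rfl (funext fun f => Plane.ext ?_)
    change _ '' _ = _
    simp
  · refine hasDerivAt_pi.2 ?_
    rintro ⟨v | f, i⟩
    · exact (EuclideanSpace.proj (𝕜 := ℝ) i).hasFDerivAt.comp_hasDerivAt (0 : ℝ) (hvert (Q.vertex v))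
    · exact (EuclideanSpace.proj (𝕜 := ℝ) i).hasFDerivAt.comp_hasDerivAt (0 : ℝ) (hface f)

/-- A function which is constant along rigid motions near a realization has derivative zero along
infinitesimal motions. -/
theorem fderiv_velocity_eq_zero {Q : Realization P} (hQ : Q.AvoidsOrigin)
    {A : E3 →L[ℝ] E3} (hA : ∀ x y, ⟪A x, y⟫_ℝ = -⟪x, A y⟫_ℝ) (τ : E3) {M : CoordSpace P → ℝ}
    (hM : DifferentiableAt ℝ M Q.coords) {c : ℝ} {s : Set (Realization P)} (hs : s ∈ 𝓝 Q)
    (hc : ∀ g, IsRigidMotion g → Q.move g ∈ s → M (Q.move g).coords = c) :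
    fderiv ℝ M Q.coords (Q.velocity (A, τ)) = 0 := by
  obtain ⟨g, hg, h0, hder⟩ := exists_hasDerivAt_coords_move hQ hA τ
  have h1 : HasDerivAt (fun t => M (Q.move (g t)).coords)
      (fderiv ℝ M Q.coords (Q.velocity (A, τ))) 0 := by
    refine HasFDerivAt.comp_hasDerivAt (0 : ℝ) ?_ hder
    rw [h0]
    exact hM.hasFDerivAt
  refine h1.unique ((hasDerivAt_const (0 : ℝ) c).congr_of_eventuallyEq ?_)
  filter_upwards [eventually_isRigidMotion hg,
    (tendsto_move hQ (tendsto_const_nhds (x := Q)) hg).eventually hs] with t ht ht'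
  exact hc _ ht ht'

end Realization

/-! ### Jacobians and extensions of measurements -/

theorem differentiable_phi {P : ConvexPolyhedron} (q : P.Incidence) :
    Differentiable ℝ (phi P q) := by
  unfold phi
  fun_prop

theorem jacobian_mulVec {P : ConvexPolyhedron} {ρ : Type*} (Φ : ρ → CoordSpace P → ℝ)
    (x w : CoordSpace P) (r : ρ) : (jacobian Φ x).mulVec w r = fderiv ℝ (Φ r) x w := by
  classical
  have h1 := (fderiv ℝ (Φ r) x).toLinearMap.pi_apply_eq_sum_univ w
  rw [ContinuousLinearMap.coe_coe] at h1
  rw [h1]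
  refine Finset.sum_congr rfl fun k _ => ?_
  have h2 : jacobian Φ x r k = fderiv ℝ (Φ r) x fun j => if k = j then 1 else 0 := by
    simp only [jacobian, Matrix.of_apply]
    congr 1
    ext j
    simp [Pi.single_apply, eq_comm]
  rw [smul_eq_mul, mul_comm, ← h2]

theorem Measurement.IsExtension.differentiableAt {P : ConvexPolyhedron} {m : Measurement P}
    {M : CoordSpace P → ℝ} (h : m.IsExtension M) :
    DifferentiableAt ℝ M P.toRealization.coords := by
  obtain ⟨W, hW, hPW, hMW, -⟩ := h
  exact (hMW.contDiffAt (hW.mem_nhds hPW)).differentiableAt (by simp)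

/-- Near `P`, the extension of a measurement agrees with the measurement. -/
theorem Measurement.IsExtension.eventually_eq {P : ConvexPolyhedron}
    (hP : P.toRealization.AvoidsOrigin) {m : Measurement P} {M : CoordSpace P → ℝ}
    (h : m.IsExtension M) :
    ∀ᶠ Q in 𝓝 P.toRealization, Q ∈ m.domain ∧ M Q.coords = m.toFun Q := by
  obtain ⟨W, hW, hPW, -, hM⟩ := h
  filter_upwards [m.isOpen_domain.mem_nhds m.mem_domain, Realization.eventually_avoidsOrigin hP,
    (Realization.continuousAt_coords hP).eventually (hW.mem_nhds hPW)] with Q h1 h2 h3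
  exact ⟨h1, hM Q h1 h2 h3⟩

/-! ### Gram–Schmidt frames -/

section Frames

open InnerProductSpace

/-- The Gram–Schmidt process is continuous at linearly independent families. -/
theorem tendsto_gramSchmidt {α : Type*} {l : Filter α} {f : α → Fin 3 → E3} {f₀ : Fin 3 → E3}
    (hf : ∀ i, Filter.Tendsto (fun a => f a i) l (𝓝 (f₀ i))) (h₀ : LinearIndependent ℝ f₀)
    (n : Fin 3) : Filter.Tendsto (fun a => gramSchmidt ℝ (f a) n) l (𝓝 (gramSchmidt ℝ f₀ n)) := by
  induction n using WellFoundedLT.induction with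
  | _ n ih =>
  have key : ∀ f : Fin 3 → E3, gramSchmidt ℝ f n = f n - ∑ i ∈ Finset.Iio n,
      (⟪gramSchmidt ℝ f i, f n⟫_ℝ / ((‖gramSchmidt ℝ f i‖ ^ 2 : ℝ) : ℝ)) • gramSchmidt ℝ f i := by
    intro f
    rw [gramSchmidt_def]
    simp only [Submodule.starProjection_singleton]
    rfl
  simp only [key]
  refine (hf n).sub (tendsto_finsetSum _ fun i hi => ?_)
  have hin := ih i (Finset.mem_Iio.1 hi)
  refine Filter.Tendsto.smul (Filter.Tendsto.div (hin.inner (hf n)) ?_ ?_) hin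
  · exact hin.norm.pow 2
  · simpa using gramSchmidt_ne_zero i h₀

/-- The orthonormal basis produced by the Gram–Schmidt process. -/
def gsBasis (f : Fin 3 → E3) : OrthonormalBasis (Fin 3) ℝ E3 :=
  gramSchmidtOrthonormalBasis (by simp) f

/-- Linear independence plays no role: where the process degenerates the basis is completed so that
these relations persist. Hence every realization, not only a nearby one, has a frame to be moved
into the slice. -/
theorem inner_gsBasis_eq_zero (f : Fin 3 → E3) {i j : Fin 3} (hij : i < j) :
    ⟪gsBasis f j, f i⟫_ℝ = 0 := gramSchmidtOrthonormalBasis_inv_triangular _ f hij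

/-- By triangularity the product of these numbers is the determinant of the family in the
orthonormal basis. -/
theorem inner_gsBasis_self_ne_zero {f : Fin 3 → E3} (hf : LinearIndependent ℝ f) (i : Fin 3) :
    ⟪gsBasis f i, f i⟫_ℝ ≠ 0 := by
  have h1 : (gsBasis f).toBasis.det f = ∏ i, ⟪gsBasis f i, f i⟫_ℝ :=
    gramSchmidtOrthonormalBasis_det _ f
  have h2 : IsUnit ((gsBasis f).toBasis.det f) :=
    (Module.Basis.is_basis_iff_det _).1 ⟨hf, hf.span_eq_top_of_card_eq_finrank (by simp)⟩
  rw [h1] at h2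
  exact Finset.prod_ne_zero_iff.1 h2.ne_zero i (Finset.mem_univ i)

theorem tendsto_gsBasis {α : Type*} {l : Filter α} {f : α → Fin 3 → E3} {f₀ : Fin 3 → E3}
    (hf : ∀ i, Filter.Tendsto (fun a => f a i) l (𝓝 (f₀ i))) (h₀ : LinearIndependent ℝ f₀)
    (n : Fin 3) : Filter.Tendsto (fun a => gsBasis (f a) n) l (𝓝 (gsBasis f₀ n)) := by
  have h1 := tendsto_gramSchmidt hf h₀ n
  have hne := gramSchmidt_ne_zero n h₀
  have happ : ∀ f : Fin 3 → E3, gramSchmidt ℝ f n ≠ 0 →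
      gsBasis f n = ‖gramSchmidt ℝ f n‖⁻¹ • gramSchmidt ℝ f n := fun f hf =>
    gramSchmidtOrthonormalBasis_apply _ (smul_ne_zero (inv_ne_zero (by simpa using hf)) hf)
  rw [happ f₀ hne]
  refine ((h1.norm.inv₀ (norm_ne_zero_iff.2 hne)).smul h1).congr' ?_
  filter_upwards [h1.eventually_ne hne] with a ha
  exact (happ _ ha).symm

/-- An isometry taking one frame, with its origin, to another. -/
theorem exists_isometry_frame (b b' : OrthonormalBasis (Fin 3) ℝ E3) (q p : E3) :
    ∃ g : E3 ≃ᵃⁱ[ℝ] E3, g q = p ∧ (∀ x, g x = p + ∑ i, ⟪b i, x - q⟫_ℝ • b' i) ∧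
      ∀ i x y, ⟪b' i, g x - g y⟫_ℝ = ⟪b i, x - y⟫_ℝ := by
  set R := b.equiv b' (Equiv.refl _) with hR
  have hRb : ∀ i, R (b i) = b' i := fun i => by simp [hR]
  have hRx : ∀ x, R x = ∑ i, ⟪b i, x⟫_ℝ • b' i := by
    intro x
    conv_lhs => rw [← b.sum_repr' x]
    simp [hRb]
  set g := ((AffineIsometryEquiv.constVAdd ℝ E3 (-q)).trans R.toAffineIsometryEquiv).trans
    (AffineIsometryEquiv.constVAdd ℝ E3 p)
  have hg : ∀ x, g x = p + R (-q + x) := fun x => rfl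
  refine ⟨g, by rw [hg, neg_add_cancel, map_zero, add_zero], fun x => ?_, fun i x y => ?_⟩
  · rw [hg, hRx, neg_add_eq_sub]
  · rw [hg, hg, add_sub_add_left_eq_sub, ← map_sub, ← hRb, LinearIsometryEquiv.inner_map_map,
      add_sub_add_left_eq_sub]

end Frames

namespace ConvexPolyhedron

variable (P : ConvexPolyhedron)

/-- A convex polyhedron has four vertices in general position. -/
theorem exists_linearIndependent_vertices :
    ∃ (v₀ : P.Vertex) (v : Fin 3 → P.Vertex), LinearIndependent ℝ fun i => (v i).1 - v₀.1 := by
  obtain ⟨v₀, hv₀⟩ : P.vertices.Nonempty := by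
    by_contra H
    rw [Set.not_nonempty_iff_eq_empty] at H
    obtain ⟨K, -⟩ := exists_plane_of_collinear (collinear_empty ℝ E3)
    exact P.vertices_not_subset_plane K (by rw [H]; exact Set.empty_subset _)
  -- A vector orthogonal to all differences would be the normal of a plane containing all vertices.
  have hspan : Submodule.span ℝ ((fun v => v - v₀) '' P.vertices) = ⊤ := by
    by_contra H
    rw [← Submodule.orthogonal_eq_bot_iff] at H
    obtain ⟨n, hn, hn0⟩ := Submodule.exists_mem_ne_zero_of_ne_bot H
    refine P.vertices_not_subset_plane (Plane.mk ⟨(n, ⟪n, v₀⟫_ℝ), hn0⟩) fun v hv => ?_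
    rw [Plane.mem_mk]
    have := (Submodule.mem_orthogonal' _ _).1 hn _ (Submodule.subset_span ⟨v, hv, rfl⟩)
    rwa [inner_sub_right, sub_eq_zero] at this
  obtain ⟨b, hb, hbs, hbl⟩ := exists_linearIndependent ℝ ((fun v => v - v₀) '' P.vertices)
  have hbasis := Module.Basis.mk hbl (by rw [Subtype.range_coe, hbs, hspan])
  have hfin : Finite b := hbl.finite
  have := Fintype.ofFinite b
  have hcard : Fintype.card b = 3 := by
    rw [← Module.finrank_eq_card_basis hbasis]; simp
  set e := (Fintype.equivFinOfCardEq hcard).symm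
  choose v hv hvb using fun i => hb (e i).2
  refine ⟨⟨v₀, hv₀⟩, fun i => ⟨v i, hv i⟩, ?_⟩
  have : (fun i => v i - v₀) = (fun x : b => (x : E3)) ∘ e := funext hvb
  rw [this]
  exact hbl.comp e e.injective

end ConvexPolyhedron

/-! ### A slice transverse to the rigid motions -/

/-- The skew-adjoint operators, parametrized by their entries in an orthonormal basis. -/
def skewOperator (b : OrthonormalBasis (Fin 3) ℝ E3) : (Fin 3 → ℝ) →ₗ[ℝ] (E3 →L[ℝ] E3) where
  toFun c :=
    c 0 • ((innerSL ℝ (b 0)).smulRight (b 1) - (innerSL ℝ (b 1)).smulRight (b 0)) +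
    c 1 • ((innerSL ℝ (b 0)).smulRight (b 2) - (innerSL ℝ (b 2)).smulRight (b 0)) +
    c 2 • ((innerSL ℝ (b 1)).smulRight (b 2) - (innerSL ℝ (b 2)).smulRight (b 1))
  map_add' c d := by simp only [Pi.add_apply]; module
  map_smul' r c := by simp only [Pi.smul_apply, smul_eq_mul, RingHom.id_apply]; module

theorem skewOperator_apply (b : OrthonormalBasis (Fin 3) ℝ E3) (c : Fin 3 → ℝ) (x : E3) :
    skewOperator b c x = c 0 • (⟪b 0, x⟫_ℝ • b 1 - ⟪b 1, x⟫_ℝ • b 0) +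
      c 1 • (⟪b 0, x⟫_ℝ • b 2 - ⟪b 2, x⟫_ℝ • b 0) +
      c 2 • (⟪b 1, x⟫_ℝ • b 2 - ⟪b 2, x⟫_ℝ • b 1) := by
  simp [skewOperator]

theorem skewOperator_inner (b : OrthonormalBasis (Fin 3) ℝ E3) (c : Fin 3 → ℝ) (x y : E3) :
    ⟪skewOperator b c x, y⟫_ℝ = -⟪x, skewOperator b c y⟫_ℝ := by
  simp only [skewOperator_apply, inner_add_left, inner_add_right, inner_sub_left, inner_sub_right,
    real_inner_smul_left, real_inner_smul_right, real_inner_comm x]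
  ring

/-- The coordinates transverse to the rigid motions, for a frame and four vertices. -/
def sliceMap {P : ConvexPolyhedron} (b : OrthonormalBasis (Fin 3) ℝ E3) (v₀ : P.Vertex)
    (v : Fin 3 → P.Vertex) : CoordSpace P →ₗ[ℝ] E3 × (Fin 3 → ℝ) where
  toFun x :=
    let p : P.Vertex → E3 := fun u => WithLp.toLp 2 fun i => x (Sum.inl u, i)
    -- The position of v₀ detects translations, the next two entries detect rotations that tilt the
    -- ray from v₀ to v 0, and the last one detects rotations about that ray.
    (p v₀, ![⟪b 1, p (v 0) - p v₀⟫_ℝ, ⟪b 2, p (v 0) - p v₀⟫_ℝ, ⟪b 2, p (v 1) - p v₀⟫_ℝ])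
  map_add' x y := by
    have h : ∀ u : P.Vertex, (WithLp.toLp 2 fun i => (x + y) (Sum.inl u, i) : E3) =
        WithLp.toLp 2 (fun i => x (Sum.inl u, i)) + WithLp.toLp 2 fun i => y (Sum.inl u, i) :=
      fun u => rfl
    ext i
    · simp
    · simp only [h]
      fin_cases i <;> simp [inner_sub_right, inner_add_right] <;> ring
  map_smul' r x := by
    have h : ∀ u : P.Vertex, (WithLp.toLp 2 fun i => (r • x) (Sum.inl u, i) : E3) =
        r • WithLp.toLp 2 (fun i => x (Sum.inl u, i)) := fun u => rfl
    ext i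
    · simp
    · simp only [h]
      fin_cases i <;> simp [inner_sub_right, real_inner_smul_right] <;> ring

theorem sliceMap_coords {P : ConvexPolyhedron} (b : OrthonormalBasis (Fin 3) ℝ E3) (v₀ : P.Vertex)
    (v : Fin 3 → P.Vertex) (Q : Realization P) :
    sliceMap b v₀ v Q.coords = (Q.vertex v₀, ![⟪b 1, Q.vertex (v 0) - Q.vertex v₀⟫_ℝ,
      ⟪b 2, Q.vertex (v 0) - Q.vertex v₀⟫_ℝ, ⟪b 2, Q.vertex (v 1) - Q.vertex v₀⟫_ℝ]) := rfl

theorem sliceMap_velocity {P : ConvexPolyhedron} (b : OrthonormalBasis (Fin 3) ℝ E3)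
    (v₀ : P.Vertex) (v : Fin 3 → P.Vertex) (Q : Realization P) (A : E3 →L[ℝ] E3) (τ : E3) :
    sliceMap b v₀ v (Q.velocity (A, τ)) = (A (Q.vertex v₀) + τ,
      ![⟪b 1, A (Q.vertex (v 0) - Q.vertex v₀)⟫_ℝ, ⟪b 2, A (Q.vertex (v 0) - Q.vertex v₀)⟫_ℝ,
        ⟪b 2, A (Q.vertex (v 1) - Q.vertex v₀)⟫_ℝ]) := by
  have h : ∀ u : P.Vertex, (WithLp.toLp 2 fun i => Q.velocity (A, τ) (Sum.inl u, i) : E3) =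
      A (Q.vertex u) + τ := fun u => rfl
  simp only [sliceMap, LinearMap.coe_mk, AddHom.coe_mk, h, add_sub_add_right_eq_sub, map_sub]

/-- The infinitesimal rigid motions at a realization, in coordinates. -/
def rigidVelocity {P : ConvexPolyhedron} (b : OrthonormalBasis (Fin 3) ℝ E3)
    (Q : Realization P) : (Fin 3 → ℝ) × E3 →ₗ[ℝ] CoordSpace P :=
  Q.velocity ∘ₗ (skewOperator b).prodMap LinearMap.id

/-- The slice is transverse to the infinitesimal rigid motions. -/
theorem eq_zero_of_sliceMap_rigidVelocity {P : ConvexPolyhedron} {Q : Realization P}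
    {v₀ : P.Vertex} {v : Fin 3 → P.Vertex}
    (hv : LinearIndependent ℝ fun i => Q.vertex (v i) - Q.vertex v₀) {m : (Fin 3 → ℝ) × E3}
    (hm : sliceMap (gsBasis fun i => Q.vertex (v i) - Q.vertex v₀) v₀ v
      (rigidVelocity (gsBasis fun i => Q.vertex (v i) - Q.vertex v₀) Q m) = 0) : m = 0 := by
  obtain ⟨c, τ⟩ := m
  set w : Fin 3 → E3 := fun i => Q.vertex (v i) - Q.vertex v₀ with hw
  set b := gsBasis w with hb
  change sliceMap b v₀ v (Q.velocity (skewOperator b c, τ)) = 0 at hm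
  rw [sliceMap_velocity, Prod.mk_eq_zero] at hm
  obtain ⟨h0, h1⟩ := hm
  have e0 := congrFun h1 0
  have e1 := congrFun h1 1
  have e2 := congrFun h1 2
  change ⟪b 1, skewOperator b c (w 0)⟫_ℝ = 0 at e0
  change ⟪b 2, skewOperator b c (w 0)⟫_ℝ = 0 at e1
  change ⟪b 2, skewOperator b c (w 1)⟫_ℝ = 0 at e2
  have hbb : ∀ i j, ⟪b i, b j⟫_ℝ = if i = j then 1 else 0 := orthonormal_iff_ite.1 b.orthonormal
  have t1 : ⟪b 1, w 0⟫_ℝ = 0 := inner_gsBasis_eq_zero w (by decide)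
  have t2 : ⟪b 2, w 0⟫_ℝ = 0 := inner_gsBasis_eq_zero w (by decide)
  have t3 : ⟪b 2, w 1⟫_ℝ = 0 := inner_gsBasis_eq_zero w (by decide)
  have n0 : ⟪b 0, w 0⟫_ℝ ≠ 0 := inner_gsBasis_self_ne_zero hv 0
  have n1 : ⟪b 1, w 1⟫_ℝ ≠ 0 := inner_gsBasis_self_ne_zero hv 1
  simp only [skewOperator_apply, inner_add_right, inner_sub_right, real_inner_smul_right, hbb,
    t1, t2, t3] at e0 e1 e2
  -- The three equations form a triangular system in c, with diagonal ⟪b 0, w 0⟫, ⟪b 0, w 0⟫, ⟪b 1,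
  -- w 1⟫.
  have c0 : c 0 = 0 := by simpa [n0] using e0
  have c1 : c 1 = 0 := by simpa [n0] using e1
  have c2 : c 2 = 0 := by simpa [n1, c1] using e2
  have hc : c = 0 := by
    ext i
    fin_cases i
    · exact c0
    · exact c1
    · exact c2
  rw [hc, map_zero, zero_apply, zero_add] at h0
  rw [hc, h0]
  rfl

/-- The realizations close to a given one can be moved into the slice by small rigid motions. -/
theorem exists_move_mem_slice {P : ConvexPolyhedron} {Q₀ : Realization P}
    {v₀ : P.Vertex} {v : Fin 3 → P.Vertex}
    (hv : LinearIndependent ℝ fun i => Q₀.vertex (v i) - Q₀.vertex v₀) :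
    ∃ g : Realization P → E3 ≃ᵃⁱ[ℝ] E3,
      (∀ x, Filter.Tendsto (fun Q => g Q x) (𝓝 Q₀) (𝓝 x)) ∧
      ∀ Q : Realization P,
        sliceMap (gsBasis fun i => Q₀.vertex (v i) - Q₀.vertex v₀) v₀ v (Q.move (g Q)).coords =
        sliceMap (gsBasis fun i => Q₀.vertex (v i) - Q₀.vertex v₀) v₀ v Q₀.coords := by
  set w : Realization P → Fin 3 → E3 := fun Q i => Q.vertex (v i) - Q.vertex v₀ with hw
  -- The motion g Q takes the Gram–Schmidt frame of Q to that of Q₀; the last three slice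
  -- coordinates then vanish for both.
  choose g hg hgx hgi using fun Q : Realization P =>
    exists_isometry_frame (gsBasis (w Q)) (gsBasis (w Q₀)) (Q.vertex v₀) (Q₀.vertex v₀)
  have hcont := (Realization.tendsto_iff.1 (Filter.tendsto_id (x := 𝓝 Q₀))).1
  refine ⟨g, fun x => ?_, fun Q => ?_⟩
  · have hb : ∀ i, Filter.Tendsto (fun Q => gsBasis (w Q) i) (𝓝 Q₀) (𝓝 (gsBasis (w Q₀) i)) :=
      tendsto_gsBasis (fun i => (hcont (v i)).sub (hcont v₀)) hv
    have hlim : Filter.Tendsto (fun Q => g Q x) (𝓝 Q₀) (𝓝 (Q₀.vertex v₀ +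
        ∑ i, ⟪gsBasis (w Q₀) i, x - Q₀.vertex v₀⟫_ℝ • gsBasis (w Q₀) i)) := by
      simp only [hgx]
      exact tendsto_const_nhds.add (tendsto_finsetSum _ fun i _ =>
        ((hb i).inner (tendsto_const_nhds.sub (hcont v₀))).smul_const _)
    rwa [(gsBasis (w Q₀)).sum_repr', add_sub_cancel] at hlim
  · have key : ∀ i j, i < j →
        ⟪gsBasis (w Q₀) j, g Q (Q.vertex (v i)) - g Q (Q.vertex v₀)⟫_ℝ = 0 := by
      intro i j hij
      rw [hgi]
      exact inner_gsBasis_eq_zero (w Q) hij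
    have key₀ : ∀ i j, i < j →
        ⟪gsBasis (w Q₀) j, Q₀.vertex (v i) - Q₀.vertex v₀⟫_ℝ = 0 := fun i j hij =>
      inner_gsBasis_eq_zero (w Q₀) hij
    rw [sliceMap_coords, sliceMap_coords]
    change (g Q (Q.vertex v₀), ![⟪gsBasis (w Q₀) 1, g Q (Q.vertex (v 0)) - g Q (Q.vertex v₀)⟫_ℝ,
      ⟪gsBasis (w Q₀) 2, g Q (Q.vertex (v 0)) - g Q (Q.vertex v₀)⟫_ℝ,
      ⟪gsBasis (w Q₀) 2, g Q (Q.vertex (v 1)) - g Q (Q.vertex v₀)⟫_ℝ]) = _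
    rw [key 0 1 (by decide), key 0 2 (by decide), key 1 2 (by decide), key₀ 0 1 (by decide),
      key₀ 0 2 (by decide), key₀ 1 2 (by decide), hg]

/-! ### The rank bound and local rigidity -/

theorem mem_ker_fromRows_jacobian {P : ConvexPolyhedron} {ρ σ : Type*}
    (Φ : ρ → CoordSpace P → ℝ) (Ψ : σ → CoordSpace P → ℝ) (x w : CoordSpace P) :
    w ∈ LinearMap.ker (Matrix.fromRows (jacobian Φ x) (jacobian Ψ x)).mulVecLin ↔
      (∀ r, fderiv ℝ (Φ r) x w = 0) ∧ ∀ s, fderiv ℝ (Ψ s) x w = 0 := by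
  rw [LinearMap.mem_ker, Matrix.mulVecLin_apply, Matrix.fromRows_mulVec]
  simp only [← jacobian_mulVec]
  constructor
  · intro H
    exact ⟨fun r => congrFun H (Sum.inl r), fun s => congrFun H (Sum.inr s)⟩
  · rintro ⟨h1, h2⟩
    ext (r | s)
    · exact h1 r
    · exact h2 s

theorem theorem2p6 (P : ConvexPolyhedron) (hP : P.toRealization.AvoidsOrigin)
    (S : Finset (Measurement P)) (ψ : S → CoordSpace P → ℝ)
    (hψ : ∀ m : S, m.1.IsExtension (ψ m)) :
    (Matrix.fromRows (jacobian (phi P) P.toRealization.coords)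
        (jacobian ψ P.toRealization.coords)).rank ≤ 3 * P.numEdges ∧
    ((Matrix.fromRows (jacobian (phi P) P.toRealization.coords)
        (jacobian ψ P.toRealization.coords)).rank = 3 * P.numEdges →
      ∀ᶠ Q in 𝓝 P.toRealization,
        (∀ m ∈ S, m.toFun Q = m.toFun P.toRealization) → Q.Congruent P.toRealization) := by
  set Q₀ := P.toRealization with hQ₀
  set J := Matrix.fromRows (jacobian (phi P) Q₀.coords) (jacobian ψ Q₀.coords) with hJ
  obtain ⟨v₀, v, hv⟩ := P.exists_linearIndependent_vertices
  have hv : LinearIndependent ℝ fun i => Q₀.vertex (v i) - Q₀.vertex v₀ := hv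
  set b := gsBasis fun i => Q₀.vertex (v i) - Q₀.vertex v₀ with hb
  have hinj : LinearMap.ker (rigidVelocity b Q₀) = ⊥ := by
    refine LinearMap.ker_eq_bot'.2 fun m hm => eq_zero_of_sliceMap_rigidVelocity hv ?_
    rw [← hb, hm, map_zero]
  have hrange : Module.finrank ℝ (LinearMap.range (rigidVelocity b Q₀)) = 6 := by
    rw [LinearMap.finrank_range_of_inj (LinearMap.ker_eq_bot.1 hinj)]
    simp
  have hext : ∀ m : S, ∀ᶠ Q in 𝓝 Q₀, Q ∈ m.1.domain ∧ ψ m Q.coords = m.1.toFun Q :=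
    fun m => (hψ m).eventually_eq hP
  have hle : LinearMap.range (rigidVelocity b Q₀) ≤ LinearMap.ker J.mulVecLin := by
    rintro _ ⟨⟨c, τ⟩, rfl⟩
    refine (mem_ker_fromRows_jacobian _ _ _ _).2 ⟨fun r => ?_, fun m => ?_⟩
    -- Incidence persists under motion, so `phi` stays zero on all realizations avoiding the origin;
    -- in the next case invariance keeps the extended measurement constant.
    · exact Realization.fderiv_velocity_eq_zero hP (skewOperator_inner b c) τ
        (differentiable_phi r _) (Realization.eventually_avoidsOrigin hP)
        fun g _ hg => Realization.phi_coords hg r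
    · exact Realization.fderiv_velocity_eq_zero hP (skewOperator_inner b c) τ
        (hψ m).differentiableAt (hext m) (c := m.1.toFun Q₀)
        fun g hg hm => hm.2.trans (m.1.invariant g hg Q₀ m.1.mem_domain hm.1)
  have hrank : J.rank + Module.finrank ℝ (LinearMap.ker J.mulVecLin) =
      (Fintype.card P.Vertex + Fintype.card P.Face) * 3 := by
    have := J.mulVecLin.finrank_range_add_finrank_ker
    rw [Module.finrank_fintype_fun_eq_card, Fintype.card_prod, Fintype.card_sum,
      Fintype.card_fin] at this
    exact this
  have hker : 6 ≤ Module.finrank ℝ (LinearMap.ker J.mulVecLin) :=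
    hrange ▸ Submodule.finrank_mono hle
  have heuler := P.card_vertex_add_card_face_le
  refine ⟨by omega, fun hfull => ?_⟩
  -- Here the same inequality is used in the other direction: 3V + 3F - 3E ≤ 6.
  have hker' : Module.finrank ℝ (LinearMap.ker J.mulVecLin) ≤ 6 := by
    rw [hfull] at hrank
    omega
  have hkereq : LinearMap.range (rigidVelocity b Q₀) = LinearMap.ker J.mulVecLin :=
    Submodule.eq_of_le_of_finrank_le hle (hker'.trans hrange.ge)
  obtain ⟨g, hg, hslice⟩ := exists_move_mem_slice hv
  have : Fintype P.Incidence := Fintype.ofFinite _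
  -- the defining equations, the measurements and the slice coordinates separate points near `P`
  set Φ : CoordSpace P → (P.Incidence → ℝ) × (S → ℝ) × (E3 × (Fin 3 → ℝ)) := fun x =>
    (fun r => phi P r x, fun m => ψ m x, LinearMap.toContinuousLinearMap (sliceMap b v₀ v) x) with hΦ
  have hderiv : HasFDerivAt Φ
      ((ContinuousLinearMap.pi fun r => fderiv ℝ (phi P r) Q₀.coords).prod
        ((ContinuousLinearMap.pi fun m => fderiv ℝ (ψ m) Q₀.coords).prod
          (LinearMap.toContinuousLinearMap (sliceMap b v₀ v)))) Q₀.coords :=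
    (hasFDerivAt_pi.2 fun r => (differentiable_phi r _).hasFDerivAt).prodMk
      ((hasFDerivAt_pi.2 fun m => (hψ m).differentiableAt.hasFDerivAt).prodMk
        (ContinuousLinearMap.hasFDerivAt _))
  -- An injective linear map in finite dimension is bounded below, so differentiability at the
  -- single point already separates it from its neighbours.
  have hanti := hderiv.eventually_ne (c := Φ Q₀.coords) (by
    obtain ⟨K, -, hK⟩ := LinearMap.exists_antilipschitzWith
      ((ContinuousLinearMap.pi fun r => fderiv ℝ (phi P r) Q₀.coords).prod
        ((ContinuousLinearMap.pi fun m => fderiv ℝ (ψ m) Q₀.coords).prod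
          (LinearMap.toContinuousLinearMap (sliceMap b v₀ v)))).toLinearMap (by
        refine LinearMap.ker_eq_bot'.2 fun w hw => ?_
        have h1 := congrArg Prod.fst hw
        have h2 := congrArg (fun z => z.2.1) hw
        have h3 : sliceMap b v₀ v w = 0 := congrArg (fun z => z.2.2) hw
        have hwker : w ∈ LinearMap.ker J.mulVecLin :=
          (mem_ker_fromRows_jacobian _ _ _ _).2 ⟨fun r => congrFun h1 r, fun m => congrFun h2 m⟩
        rw [← hkereq] at hwker
        obtain ⟨m, rfl⟩ := hwker
        rw [eq_zero_of_sliceMap_rigidVelocity hv h3, map_zero])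
    exact ⟨K, hK⟩)
  rw [eventually_nhdsWithin_iff] at hanti
  have hmove : Filter.Tendsto (fun Q : Realization P => Q.move (g Q)) (𝓝 Q₀) (𝓝 Q₀) :=
    Realization.tendsto_move hP Filter.tendsto_id hg
  have havoid := Realization.eventually_avoidsOrigin hP
  -- Both Q and the moved Q must lie in the domains of the measurements before invariance can be
  -- applied.
  filter_upwards [eventually_isRigidMotion hg, hmove.eventually havoid,
    hmove.eventually ((Realization.continuousAt_coords hP).eventually hanti),
    Filter.eventually_all.2 hext, hmove.eventually (Filter.eventually_all.2 hext)]
    with Q hrigid hav hne hQ hQ' hmeas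
  refine ⟨g Q, hrigid, Realization.coords_injOn hav hP ?_⟩
  by_contra hcon
  refine hne hcon ?_
  refine Prod.ext ?_ (Prod.ext ?_ (hslice Q))
  · ext r
    exact (Realization.phi_coords hav r).trans (Realization.phi_coords hP r).symm
  · ext m
    change ψ m _ = ψ m _
    rw [(hQ' m).2, m.1.invariant (g Q) hrigid Q (hQ m).1 (hQ' m).1, hmeas m m.2,
      ((hext m).self_of_nhds).2]

end
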